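/- **Setting.** For $s\in\mathbb R$ let $\omega_0^s=1$, $\omega_k^s=k^s$ ($k\ge1$), and let $\Omega^s$ be the normed space of real sequences $x=(x_k)_{k\ge0}$ with $\|x\|_s=\sup_k|x_k|\omega_k^s<\infty$; $B_0(r)=\{x\in\Omega^s:\|x\|_s\le r\}$. Let $(x*y)_k=\sum_{k_1+k_2=k,\;k_i\in\mathbb Z}x_{|k_1|}y_{|k_2|}$. Fix $s\ge2$, $s_L>0$, $\sigma\in\mathbb R$, $g\in\Omega^s$ and real sequences $(\lambda_k),(\mu_k),(\beta_k)$ for which there are $0<C_1\le C_2$, $k_0\ge0$ and $\delta\in(0,\frac12)$ with $$|\lambda_k|,|\mu_k|,|\beta_k|\le C_2\,\omega_k^{s_L}\ (k\ge0),\qquad |\mu_k|\ge C_1\omega_k^{s_L},\quad |\lambda_k/\mu_k|,|\beta_k/\mu_k|\le\delta\ (k\ge k_0).$$ Put $\mathcal L_0(x)=\mu_0x_0+\beta_0x_1$, $\mathcal L_k(x)=\lambda_kx_{k-1}+\mu_kx_k+\beta_kx_{k+1}$ ($k\ge1$) and $f(x)=\mathcal L(x)+\sigma(x*x)+g$. Let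 $m\ge\max(6,k_0)$, let $\bar x=(\bar x_0,\dots,\bar x_{m-1},0,0,\dots)$, let $f^{(m)}:\mathbb R^m\to\mathbb R^m$ be the truncation $x_F\mapsto(f(x_F,0,0,\dots)_k)_{k<m}$, and $D=Df^{(m)}(\bar x)$. Write $x_F=(x_0,\dots,x_{m-1})$, $x_I=(x_m,x_{m+1},\dots)$. Let $A^\dagger$ be the linear operator with $(A^\dagger z)_F=Dz_F+\beta_{m-1}z_m e_{m-1}$, where $e_{m-1}$ is the last unit vector of $\mathbb R^m$, and $(A^\dagger z)_k=\mathcal L_k(z)$ for $k\ge m$. **The operators $A$ and $T$.** Put $a_n=\lambda_{m+n-1}$, $b_n=\mu_{m+n-1}$, $c_n=\beta_{m+n-1}$, $\delta_0=1$, $\delta_1=b_1$, $\delta_n=b_n\delta_{n-1}-a_nc_{n-1}\delta_{n-2}$ and, for $k\ge 0$, $$(L_I^{-1}y_I)_k=y_{m+k}+\sum_{l=1}^k(-1)^la_{k-l+2}\cdots a_{k+1}\tfrac{\delta_{k-l}}{\delta_k}y_{m+k-l},\qquad (U_I^{-1}z_I)_k=\tfrac{\delta_k}{\delta_{k+1}}z_{m+k}+\sum_{l\ge1}(-1)^l\tfrac{\delta_k}{\delta_{k+l+1}}c_{k+1}\cdots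 c_{k+l}z_{m+k+l}.$$ Put $Q=U_I^{-1}L_I^{-1}$, $w=Q\,(1,0,0,\dots)^T$ with entries $w_0,w_1,\dots$. For an integer $L\ge0$ let $\tilde w=\frac{\delta_0}{\delta_1}+\sum_{l=1}^{L-1}\frac{\delta_0^2}{\delta_l\delta_{l+1}}c_1\cdots c_l\,a_2\cdots a_{l+1}$, and let $\tilde K$ be $D$ with $\beta_{m-1}\lambda_m\tilde w$ subtracted from its entry $(m-1,m-1)$. Let $A_m$ be any real $m\times m$ matrix (in practice a numerical inverse of $\tilde K$), with last column $(A_m)_{c}$, last row $(A_m)_{r}$ and last diagonal entry $\alpha_*=(A_m)_{m-1,m-1}$. Let $$(Ay)_F=A_my_F-\beta_{m-1}(Qy_I)_0(A_m)_{c},\qquad (Ay)_{m+k}=-\lambda_m\big((A_m)_{r}\,y_F\big)w_k+(Qy_I)_k+\beta_{m-1}\lambda_m\alpha_*(Qy_I)_0w_k,$$ and $T(x)=x-Af(x)$. **Constants.** Let $\gamma=\frac12+\sqrt{\frac14-\delta^2}$, $\theta=\delta/\gamma$, $\eta=\frac1{\gamma(1-\theta^2)}$. Let $M$ be an integer with $$(M_A)\quad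 M\ge\max\Big(\tfrac{-m\ln\sqrt\theta-s-s_L-1-\sqrt{(m\ln\sqrt\theta+s+s_L+1)^2-4m\ln\sqrt\theta}}{2\ln\sqrt\theta},\tfrac4{(\ln\theta)^2},m\Big),\qquad (M_Y)\quad M\ge\max\Big(\tfrac{-s}{\ln\theta}-m,\;m-2\Big),$$ $$\chi=\theta^{M/2}\tfrac M2\big(\tfrac{m+M}m\big)^{s+s_L}+\theta^{\sqrt M}\tfrac M2 2^{s+s_L}+\tfrac1{1-\theta}\big(\tfrac{m+M}{m+M-\sqrt M-1}\big)^{s+s_L}.$$ For an integer $N\ge1$ let $S=2\sum_{l=1}^Nl^{-s}+\frac2{(s-1)N^{s-1}}$ and $\alpha_0=1+S$, $\alpha_k=2+S+\sum_{l=1}^{k-1}\frac{k^s}{l^s(k-l)^s}$ for $1\le k<m$, and $\alpha_k=2+S+2\big(\frac m{m-1}\big)^s+\big(\frac{4\ln(m-2)}m+\frac{\pi^2-6}3\big)\big(\frac2m+\frac12\big)^{s-2}$ for $k\ge m$. **The bounds.** Absolute values of vectors and matrices, and inequalities between them, are componentwise. Let $W=(1/\omega_0^s,\dots,1/\omega_{m-1}^s)^T$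 and $\varepsilon=\frac{|\beta_{m-1}||\lambda_m|\theta^{2L}}{|\mu_m|\,\omega_{m-1}^s(1-\theta^2)}$. Then $$Z^1_F(r)=\big(|I-A_m\tilde K|W+\varepsilon|(A_m)_{c}|\big)r,\qquad Z^1_{m+k}(r)=\big((|I-A_m\tilde K|W)_{m-1}+\varepsilon|\alpha_*|\big)\eta\theta^k\tfrac{|\lambda_m|}{|\mu_m|}r\ \ (0\le k\le M),$$ and $Z^1_{m+k}=Z^1_{m+M}\,\omega_{m+M}^s/\omega_{m+k}^s$ for $k>M$. Let $C^1_k=2|\sigma|\sum_{l=m-k}^{m-1}|\bar x_l|/\omega_{k+l}^s$ and $C^2_k=2|\sigma|\alpha_k/\omega_k^s$ for $0\le k<m$, $\kappa_1=2|\sigma|\alpha_m\|\bar x\|_s$, $\kappa_2=2|\sigma|\alpha_m$. For $i=1,2$ put $q_i=\frac{|\beta_{m-1}|\,\eta\,\kappa_i}{C_1(1-\theta)\,\omega_m^{s+s_L}}$ and $$D^i_F=|A_m|C^i_F+q_i|(A_m)_{c}|,\qquad D^i_{m+k}=\big(|(A_m)_{r}|C^i_F+q_i|\alpha_*|\big)\eta\tfrac{|\lambda_m|}{|\mu_m|}\theta^k+\tfrac{\eta\kappa_i}{C_1\omega_{m+k}^{s+s_L}}\Big(E_k+\tfrac\theta{1-\theta}\Big)\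 \ (0\le k\le M),$$ with $E_k=\sum_{l=0}^k\theta^{k-l}\big(\frac{m+k}{m+l}\big)^{s+s_L}$ for $k<M$ and $E_M=\chi$, and $D^i_{m+k}=D^i_{m+M}\,\omega_{m+M}^s/\omega_{m+k}^s$ for $k>M$. Finally let $Z^2(r)=D^1r+D^2r^2$ and $Z(r)=Z^1(r)+Z^2(r)$. **Claim.** $f$ maps $\Omega^s$ into $\Omega^{s-s_L}$, $T$ maps $\Omega^s$ into $\Omega^s$, both maps are Fréchet differentiable, and for all $r>0$ and all $y,z\in B_0(r)$, componentwise, $$\big|(I-AA^\dagger)z\big|\le Z^1(r),\qquad \big|A\big(Df(\bar x+y)-A^\dagger\big)z\big|\le Z^2(r),\qquad \big|DT(\bar x+y)z\big|\le Z(r).$$ -/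

import Mathlib

namespace TridiagNewton

noncomputable section

/-! ## The weighted sequence spaces `Ω^s` -/

/-- The weight `ω_k^s`: it is `1` for `k = 0` and `k^s` for `k ≥ 1`. -/
def wt (s : ℝ) (k : ℕ) : ℝ := if k = 0 then 1 else (k : ℝ) ^ s

theorem wt_pos (s : ℝ) (k : ℕ) : 0 < wt s k := by
  unfold wt
  split_ifs with h
  · exact one_pos
  · exact Real.rpow_pos_of_pos (by exact_mod_cast Nat.pos_of_ne_zero h) s

/-- `x ∈ Ω^s`, that is `sup_k |x_k| ω_k^s < ∞`. -/
def MemOmega (s : ℝ) (x : ℕ → ℝ) : Prop :=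
  BddAbove (Set.range fun k => |x k| * wt s k)

/-- `‖x‖_s = sup_k |x_k| ω_k^s`. -/
def omegaNorm (s : ℝ) (x : ℕ → ℝ) : ℝ := ⨆ k, |x k| * wt s k

theorem memOmega_iff {s : ℝ} {x : ℕ → ℝ} :
    MemOmega s x ↔ ∃ C, ∀ k, |x k| * wt s k ≤ C := by
  constructor
  · rintro ⟨C, hC⟩
    exact ⟨C, fun k => hC ⟨k, rfl⟩⟩
  · rintro ⟨C, hC⟩
    refine ⟨C, ?_⟩
    rintro _ ⟨k, rfl⟩
    exact hC k

theorem le_omegaNorm {s : ℝ} {x : ℕ → ℝ} (hx : MemOmega s x) (k : ℕ) :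
    |x k| * wt s k ≤ omegaNorm s x :=
  le_ciSup hx k

theorem abs_add_mul_le {s : ℝ} (x y : ℕ → ℝ) (k : ℕ) :
    |x k + y k| * wt s k ≤ |x k| * wt s k + |y k| * wt s k := by
  rw [← add_mul]
  exact mul_le_mul_of_nonneg_right (abs_add_le _ _) (wt_pos s k).le

/-- `Ω^s` as a vector space of real sequences. -/
def omegaSubmodule (s : ℝ) : Submodule ℝ (ℕ → ℝ) where
  carrier := {x | MemOmega s x}
  zero_mem' := memOmega_iff.2 ⟨0, fun k => by simp⟩
  add_mem' := by
    intro x y hx hy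
    exact memOmega_iff.2 ⟨omegaNorm s x + omegaNorm s y, fun k =>
      (abs_add_mul_le x y k).trans (add_le_add (le_omegaNorm hx k) (le_omegaNorm hy k))⟩
  smul_mem' := by
    intro c x hx
    refine memOmega_iff.2 ⟨|c| * omegaNorm s x, fun k => ?_⟩
    simp only [Pi.smul_apply, smul_eq_mul, abs_mul, mul_assoc]
    exact mul_le_mul_of_nonneg_left (le_omegaNorm hx k) (abs_nonneg c)

/-- The normed space `Ω^s`. It is not reducible to a subtype of `ℕ → ℝ`, so that its topology is
that of the norm `‖·‖_s` and not the one of pointwise convergence. -/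
def Omega (s : ℝ) : Type := omegaSubmodule s

instance (s : ℝ) : AddCommGroup (Omega s) := inferInstanceAs (AddCommGroup (omegaSubmodule s))

instance (s : ℝ) : Module ℝ (Omega s) := inferInstanceAs (Module ℝ (omegaSubmodule s))

/-- The sequence underlying an element of `Ω^s`. -/
def Omega.seq {s : ℝ} (x : Omega s) : ℕ → ℝ := x.1

theorem Omega.mem {s : ℝ} (x : Omega s) : MemOmega s x.seq := x.2

/-- A sequence in `Ω^s`, as an element of the space. -/
def Omega.mk {s : ℝ} (x : ℕ → ℝ) (hx : MemOmega s x) : Omega s := ⟨x, hx⟩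

theorem Omega.ext {s : ℝ} {x y : Omega s} (h : ∀ k, x.seq k = y.seq k) : x = y :=
  Subtype.ext (funext h)

instance (s : ℝ) : Norm (Omega s) := ⟨fun x => omegaNorm s x.seq⟩

theorem omega_normedSpaceCore (s : ℝ) : NormedSpace.Core ℝ (Omega s) where
  norm_nonneg x := Real.iSup_nonneg fun k => mul_nonneg (abs_nonneg _) (wt_pos s k).le
  norm_smul c x := by
    change (⨆ k, |c * x.seq k| * wt s k) = |c| * ⨆ k, |x.seq k| * wt s k
    rw [Real.mul_iSup_of_nonneg (abs_nonneg c)]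
    simp only [abs_mul, mul_assoc]
  norm_triangle x y := by
    refine ciSup_le fun k => (abs_add_mul_le x.seq y.seq k).trans ?_
    exact add_le_add (le_omegaNorm x.mem k) (le_omegaNorm y.mem k)
  norm_eq_zero_iff x := by
    constructor
    · intro h
      refine Omega.ext fun k => ?_
      have h1 : |x.seq k| * wt s k ≤ 0 := (le_omegaNorm x.mem k).trans_eq h
      have h2 : |x.seq k| ≤ 0 := by
        by_contra hc
        exact absurd h1 (not_le.2 (mul_pos (not_le.1 hc) (wt_pos s k)))
      exact abs_nonpos_iff.1 h2
    · rintro rfl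
      change (⨆ k, |(0 : ℝ)| * wt s k) = 0
      simp

instance (s : ℝ) : NormedAddCommGroup (Omega s) :=
  NormedAddCommGroup.ofCore (omega_normedSpaceCore s)

instance (s : ℝ) : NormedSpace ℝ (Omega s) := NormedSpace.ofCore (omega_normedSpaceCore s)

/-! ## The discrete convolution -/

/-- `(x * y)_k = ∑_{k₁ + k₂ = k} x̃_{k₁} ỹ_{k₂}` over all integers `k₁, k₂`, where `x̃, ỹ` are the
even extensions of `x, y` to `ℤ`. -/
def conv (x y : ℕ → ℝ) (k : ℕ) : ℝ := ∑' j : ℤ, x j.natAbs * y ((k : ℤ) - j).natAbs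

/-- The constants `α_k^s(n)` of the convolution estimate, with computational parameter `N`. -/
def alpha (s : ℝ) (n N k : ℕ) : ℝ :=
  if k = 0 then
    1 + 2 * ∑ l ∈ Finset.Icc 1 N, 1 / (l : ℝ) ^ s + 2 / ((s - 1) * (N : ℝ) ^ (s - 1))
  else if k < n then
    2 + 2 * ∑ l ∈ Finset.Icc 1 N, 1 / (l : ℝ) ^ s + 2 / ((s - 1) * (N : ℝ) ^ (s - 1))
      + ∑ l ∈ Finset.Icc 1 (k - 1), (k : ℝ) ^ s / ((l : ℝ) ^ s * ((k : ℝ) - l) ^ s)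
  else
    2 + 2 * ∑ l ∈ Finset.Icc 1 N, 1 / (l : ℝ) ^ s + 2 / ((s - 1) * (N : ℝ) ^ (s - 1))
      + 2 * ((n : ℝ) / ((n : ℝ) - 1)) ^ s
      + (4 * Real.log ((n : ℝ) - 2) / n + (Real.pi ^ 2 - 6) / 3)
        * (2 / (n : ℝ) + 1 / 2) ^ (s - 2)

/-! ## The data of the problem -/

/-- The data: the decay rate `s`, the order `sL` of the tridiagonal part, its coefficients
`λ, μ, β`, the nonlinearity `N(x) = σ (x * x) + g`, the constants `δ` and `C₁` of the growth
assumptions, the size `m` of the projection, the numerical approximation `x̄`, the numerical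
inverse `A_m` and the computational parameters `L` (truncation of `(w_I)_0`) and `N`
(truncation in the convolution estimate). -/
structure Data where
  s : ℝ
  sL : ℝ
  lam : ℕ → ℝ
  mu : ℕ → ℝ
  beta : ℕ → ℝ
  sigma : ℝ
  g : ℕ → ℝ
  delta : ℝ
  C1 : ℝ
  m : ℕ
  m_pos : 0 < m
  xbar : Fin m → ℝ
  Am : Matrix (Fin m) (Fin m) ℝ
  L : ℕ
  N : ℕ

namespace Data

variable (P : Data)

/-- The growth assumptions on the tridiagonal part, with constants `C₁ ≤ C₂`, `δ` and `k₀`. -/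
structure Assumptions (C2 : ℝ) (k0 : ℕ) : Prop where
  C1_pos : 0 < P.C1
  C1_le_C2 : P.C1 ≤ C2
  lam_le : ∀ k, |P.lam k / wt P.sL k| ≤ C2
  mu_le : ∀ k, |P.mu k / wt P.sL k| ≤ C2
  beta_le : ∀ k, |P.beta k / wt P.sL k| ≤ C2
  le_mu : ∀ k, k0 ≤ k → P.C1 ≤ |P.mu k / wt P.sL k|
  delta_pos : 0 < P.delta
  delta_lt : P.delta < 1 / 2
  lam_ratio : ∀ k, k0 ≤ k → |P.lam k / P.mu k| ≤ P.delta
  beta_ratio : ∀ k, k0 ≤ k → |P.beta k / P.mu k| ≤ P.delta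

/-- The tridiagonal operator `𝓛`. -/
def tri (x : ℕ → ℝ) : ℕ → ℝ
  | 0 => P.mu 0 * x 0 + P.beta 0 * x 1
  | k + 1 => P.lam (k + 1) * x k + P.mu (k + 1) * x (k + 1) + P.beta (k + 1) * x (k + 2)

/-- `f(x) = 𝓛(x) + N(x)` with the quadratic nonlinearity `N(x) = σ (x * x) + g`. -/
def f (x : ℕ → ℝ) (k : ℕ) : ℝ := P.tri x k + (P.sigma * conv x x k + P.g k)

/-- A finite vector `x_F`, identified with the sequence `(x_F, 0, 0, …)`. -/
def pad (x : Fin P.m → ℝ) (k : ℕ) : ℝ := if h : k < P.m then x ⟨k, h⟩ else 0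

theorem memOmega_pad (t : ℝ) (x : Fin P.m → ℝ) : MemOmega t (P.pad x) := by
  refine memOmega_iff.2 ⟨∑ i : Fin P.m, |x i| * wt t i, fun k => ?_⟩
  have h0 : ∀ i : Fin P.m, 0 ≤ |x i| * wt t i := fun i =>
    mul_nonneg (abs_nonneg _) (wt_pos t i).le
  unfold pad
  split_ifs with h
  · exact Finset.single_le_sum (f := fun i : Fin P.m => |x i| * wt t i)
      (fun i _ => h0 i) (Finset.mem_univ (⟨k, h⟩ : Fin P.m))
  · simpa using Finset.sum_nonneg fun i (_ : i ∈ Finset.univ) => h0 i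

/-- The numerical approximation `x̄` as an element of `Ω^s`. -/
def xbarOmega : Omega P.s := Omega.mk (P.pad P.xbar) (P.memOmega_pad P.s P.xbar)

/-- The finite dimensional projection `f^{(m)} : ℝ^m → ℝ^m` of `f`. -/
def fm (x : Fin P.m → ℝ) (i : Fin P.m) : ℝ := P.f (P.pad x) i

/-- `D = Df^{(m)}(x̄)`, the Jacobian matrix. -/
def D : Matrix (Fin P.m) (Fin P.m) ℝ :=
  LinearMap.toMatrix' (fderiv ℝ P.fm P.xbar : (Fin P.m → ℝ) →ₗ[ℝ] (Fin P.m → ℝ))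

/-- The index `m - 1`. -/
def last : Fin P.m := ⟨P.m - 1, Nat.sub_lt P.m_pos one_pos⟩

/-- The operator `A†`: the block `D` coupled to the tridiagonal tail. -/
def Adag (z : ℕ → ℝ) (k : ℕ) : ℝ :=
  if h : k < P.m then
    (∑ j, P.D ⟨k, h⟩ j * z j) + (if k = P.m - 1 then P.beta (P.m - 1) * z P.m else 0)
  else P.tri z k

/-! ### The LU-decomposition of the tail -/

/-- `a_n = λ_{m+n-1}`, for `n ≥ 2`. -/
def a (n : ℕ) : ℝ := P.lam (P.m + n - 1)

/-- `b_n = μ_{m+n-1}`, for `n ≥ 1`. -/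
def b (n : ℕ) : ℝ := P.mu (P.m + n - 1)

/-- `c_n = β_{m+n-1}`, for `n ≥ 1`. -/
def c (n : ℕ) : ℝ := P.beta (P.m + n - 1)

/-- The leading principal minors `δ_n` of the tail. -/
def dlt : ℕ → ℝ
  | 0 => 1
  | 1 => P.b 1
  | n + 2 => P.b (n + 2) * dlt (n + 1) - P.a (n + 2) * P.c (n + 1) * dlt n

/-- `L_I^{-1} y_I`; tails `(y_m, y_{m+1}, …)` are indexed from `0`. -/
def LIinv (y : ℕ → ℝ) (k : ℕ) : ℝ :=
  y k + ∑ l ∈ Finset.Icc 1 k,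
    (-1) ^ l * (∏ i ∈ Finset.Icc (k - l + 2) (k + 1), P.a i) * (P.dlt (k - l) / P.dlt k) * y (k - l)

/-- `U_I^{-1} z_I`; the series over `l ≥ 1` is written with `l + 1`, `l ≥ 0`. -/
def UIinv (z : ℕ → ℝ) (k : ℕ) : ℝ :=
  P.dlt k / P.dlt (k + 1) * z k + ∑' l : ℕ,
    (-1) ^ (l + 1) * (P.dlt k / P.dlt (k + (l + 1) + 1))
      * (∏ i ∈ Finset.Icc (k + 1) (k + (l + 1)), P.c i) * z (k + (l + 1))

/-- `U_I^{-1} L_I^{-1} y_I`. -/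
def tailInv (y : ℕ → ℝ) : ℕ → ℝ := P.UIinv (P.LIinv y)

/-- `w_I = U_I^{-1} L_I^{-1} e_1`. -/
def w : ℕ → ℝ := P.tailInv (Pi.single 0 1)

/-- `w̃`, the truncation of the series of `(w_I)_0`. -/
def wtilde : ℝ :=
  P.dlt 0 / P.dlt 1 + ∑ l ∈ Finset.Ico 1 P.L,
    P.dlt 0 ^ 2 / (P.dlt l * P.dlt (l + 1))
      * (∏ i ∈ Finset.Icc 1 l, P.c i) * ∏ i ∈ Finset.Icc 2 (l + 1), P.a i

/-- `K̃ = D - β_{m-1} λ_m w̃ E_{m-1,m-1}`. -/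
def Ktilde : Matrix (Fin P.m) (Fin P.m) ℝ :=
  P.D - (P.beta (P.m - 1) * P.lam P.m) • Matrix.single P.last P.last P.wtilde

/-- The tail `y_I = (y_m, y_{m+1}, …)`. -/
def tail (y : ℕ → ℝ) (k : ℕ) : ℝ := y (P.m + k)

/-- The approximate inverse `A` of `A†`, built from `A_m`. -/
def A (y : ℕ → ℝ) (k : ℕ) : ℝ :=
  if h : k < P.m then
    (∑ j, P.Am ⟨k, h⟩ j * y j)
      - P.beta (P.m - 1) * (P.Am ⟨k, h⟩ P.last * P.tailInv (P.tail y) 0)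
  else
    -P.lam P.m * (P.w (k - P.m) * ∑ j, P.Am P.last j * y j)
      + P.tailInv (P.tail y) (k - P.m)
      + P.beta (P.m - 1) * P.lam P.m * P.Am P.last P.last
        * (P.w (k - P.m) * P.tailInv (P.tail y) 0)

/-- The Newton-like operator `T(x) = x - A f(x)`. -/
def T (x : ℕ → ℝ) (k : ℕ) : ℝ := x k - P.A (P.f x) k

/-! ### The constants -/

/-- `γ = 1/2 + √(1/4 - δ²)`. -/
def gamma : ℝ := 1 / 2 + Real.sqrt (1 / 4 - P.delta ^ 2)

/-- `θ = δ / γ`. -/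
def theta : ℝ := P.delta / P.gamma

/-- `η = 1 / (γ (1 - θ²))`. -/
def eta : ℝ := 1 / (P.gamma * (1 - P.theta ^ 2))

/-- `χ = χ(θ, m, M, s, s_L)`. -/
def chi (M : ℕ) : ℝ :=
  P.theta ^ ((M : ℝ) / 2) * ((M : ℝ) / 2) * (((P.m : ℝ) + M) / P.m) ^ (P.s + P.sL)
    + P.theta ^ Real.sqrt M * ((M : ℝ) / 2) * (2 : ℝ) ^ (P.s + P.sL)
    + 1 / (1 - P.theta)
      * (((P.m : ℝ) + M) / ((P.m : ℝ) + M - Real.sqrt M - 1)) ^ (P.s + P.sL)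

/-- The condition `(M_A)`. -/
def CondMA (M : ℕ) : Prop :=
  max (max
    ((-P.m * Real.log (Real.sqrt P.theta) - P.s - P.sL - 1
        - Real.sqrt ((P.m * Real.log (Real.sqrt P.theta) + P.s + P.sL + 1) ^ 2
            - 4 * P.m * Real.log (Real.sqrt P.theta)))
      / (2 * Real.log (Real.sqrt P.theta)))
    (4 / Real.log P.theta ^ 2)) (P.m : ℝ) ≤ M

/-- The condition `(M_Y)`. -/
def CondMY (M : ℕ) : Prop :=
  max (-P.s / Real.log P.theta - P.m) ((P.m : ℝ) - 2) ≤ M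

/-! ### The bounds -/

/-- The common factor `|β_{m-1}| |λ_m| θ^{2L} / (|μ_m| ω_{m-1}^s (1 - θ²))` of `Z¹`, which
accounts for the truncation error of `w̃`. -/
def truncErr : ℝ :=
  |P.beta (P.m - 1)| * |P.lam P.m| * P.theta ^ (2 * P.L)
    / (|P.mu P.m| * wt P.s (P.m - 1) * (1 - P.theta ^ 2))

/-- `|I - A_m K̃| W_F^s`. -/
def defect (i : Fin P.m) : ℝ :=
  ∑ j : Fin P.m, |(1 - P.Am * P.Ktilde) i j| * (1 / wt P.s j)

/-- The value of `Z¹_{m+k}` for `0 ≤ k ≤ M`. -/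
def Z1tail (r : ℝ) (k : ℕ) : ℝ :=
  (P.defect P.last + P.truncErr * |P.Am P.last P.last|)
    * P.eta * P.theta ^ k * (|P.lam P.m| / |P.mu P.m|) * r

/-- The bound `Z¹(r)`. -/
def Z1 (M : ℕ) (r : ℝ) (k : ℕ) : ℝ :=
  if h : k < P.m then
    (P.defect ⟨k, h⟩ + P.truncErr * |P.Am ⟨k, h⟩ P.last|) * r
  else if k - P.m ≤ M then P.Z1tail r (k - P.m)
  else P.Z1tail r M * (wt P.s (P.m + M) / wt P.s k)

/-- The finite part `C¹_F(x̄)`; the sum is empty for `k = 0`. -/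
def C1F (k : Fin P.m) : ℝ :=
  2 * |P.sigma| * ∑ l ∈ Finset.Icc (P.m - k) (P.m - 1), |P.pad P.xbar l| / wt P.s (k + l)

/-- The finite part `C²_F`. -/
def C2F (k : Fin P.m) : ℝ := 2 * |P.sigma| * alpha P.s P.m P.N k / wt P.s k

/-- The part of `D^i_{m+k}` that is due to the coupling with the finite block. Here `C` is the
finite part of `C^i`, and `κ` is the constant with `C^i_{m+k} = κ / ω_{m+k}^s`. -/
def Dcoupling (C : Fin P.m → ℝ) (κ : ℝ) (k : ℕ) : ℝ :=
  ((∑ j, |P.Am P.last j| * C j)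
    + |P.beta (P.m - 1)| * |P.Am P.last P.last| * P.eta * κ
      / (P.C1 * (1 - P.theta) * wt (P.s + P.sL) P.m))
    * P.eta * (|P.lam P.m| / |P.mu P.m|) * P.theta ^ k

/-- The value at the index `m + M`. -/
def DatM (C : Fin P.m → ℝ) (κ : ℝ) (M : ℕ) : ℝ :=
  P.Dcoupling C κ M
    + P.eta * κ / (P.C1 * wt (P.s + P.sL) (P.m + M))
      * (P.chi M + P.theta / (1 - P.theta))

/-- The common shape of `D¹` and `D²`. -/
def Dbound (C : Fin P.m → ℝ) (κ : ℝ) (M k : ℕ) : ℝ :=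
  if h : k < P.m then
    (∑ j, |P.Am ⟨k, h⟩ j| * C j)
      + |P.beta (P.m - 1)| * P.eta * κ / (P.C1 * (1 - P.theta) * wt (P.s + P.sL) P.m)
        * |P.Am ⟨k, h⟩ P.last|
  else if k - P.m < M then
    P.Dcoupling C κ (k - P.m)
      + P.eta * κ / (P.C1 * wt (P.s + P.sL) k)
        * ((∑ l ∈ Finset.range (k - P.m + 1),
              P.theta ^ (k - P.m - l) * ((k : ℝ) / ((P.m : ℝ) + l)) ^ (P.s + P.sL))
            + P.theta / (1 - P.theta))
  else if k - P.m = M then P.DatM C κ M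
  else P.DatM C κ M * (wt P.s (P.m + M) / wt P.s k)

/-- The bound `D¹(x̄)`. -/
def D1 (M k : ℕ) : ℝ :=
  P.Dbound P.C1F
    (2 * |P.sigma| * alpha P.s P.m P.N P.m * omegaNorm P.s (P.pad P.xbar)) M k

/-- The bound `D²`. -/
def D2 (M k : ℕ) : ℝ :=
  P.Dbound P.C2F (2 * |P.sigma| * alpha P.s P.m P.N P.m) M k

/-- The bound `Z²(r) = D¹(x̄) r + D² r²`. -/
def Z2 (M : ℕ) (r : ℝ) (k : ℕ) : ℝ := P.D1 M k * r + P.D2 M k * r ^ 2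

/-- The bound `Z(r) = Z¹(r) + Z²(r)`. -/
def Z (M : ℕ) (r : ℝ) (k : ℕ) : ℝ := P.Z1 M r k + P.Z2 M r k

end Data

end

end TridiagNewton

namespace TridiagNewton

/-! ## Weights -/

/-! The tail of `𝓛` is a diagonally dominant tridiagonal matrix, and `U_I^{-1} L_I^{-1}` is its
inverse by elimination. The constant `γ` is the larger root of `γ = 1 - δ²/γ`, the fixed point of
the pivot recursion, so every pivot keeps at least the fraction `γ` of its diagonal entry
(`dlt_ne_zero_and_le_piv`). Off-diagonal entries divided by pivots are then at most `θ`, and the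
entries of the inverse decay like `θ^{|k-j|}` (`TailDominant.abs_tailInv_le`). Since the pivots grow
like `ω^{s_L}`, this inverse gains `s_L` orders of decay, which is why `A` maps `Ω^{s-s_L}` into
`Ω^s` and `T` maps `Ω^s` into itself.

The operator `A` is block elimination applied to `A†`: with `A_m` an exact inverse of the Schur
complement, which contains `w_0`, it would invert `A†`. Two errors remain: `A_m` is only an
approximate inverse of `K̃`, and `K̃` uses the partial sum `w̃` in place of `w_0`. The second is a
geometric remainder (`abs_w_zero_sub_wtilde_le`). The tail of `(I - AA†)z` is a multiple of its last
finite entry, which gives `Z¹`.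

In `Df(x̄ + y)z - A†z` all tridiagonal terms cancel, leaving convolutions. They are controlled by
`abs_conv_le`, whose constants `α_k` bound the self-convolution of `1/ω^s`. Applying `A` to a
sequence of size `1/ω^s` (`abs_A_le_Dbound`) gives `Z²`. Indices beyond `m + M` are covered by the
bound at `m + M`, because `(M_A)` and `(M_Y)` place `M` where the functions involved have become
decreasing.

Both maps are differentiable because `f` is a bounded linear map plus a bounded quadratic map plus a
constant, and `A` is bounded and linear. The last bound follows from `DT = (I - AA†) - A(Df - A†)`.
-/

theorem wt_of_pos {s : ℝ} {k : ℕ} (hk : 0 < k) : wt s k = (k : ℝ) ^ s := if_neg hk.ne'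

theorem one_le_wt {s : ℝ} (hs : 0 ≤ s) (k : ℕ) : 1 ≤ wt s k := by
  rcases Nat.eq_zero_or_pos k with rfl | hk
  · simp [wt]
  · rw [wt_of_pos hk]
    exact Real.one_le_rpow (by exact_mod_cast hk) hs

theorem wt_le_wt_of_exponent_le {s t : ℝ} (h : s ≤ t) (k : ℕ) : wt s k ≤ wt t k := by
  rcases Nat.eq_zero_or_pos k with rfl | hk
  · simp [wt]
  · rw [wt_of_pos hk, wt_of_pos hk]
    exact Real.rpow_le_rpow_of_exponent_le (by exact_mod_cast hk) h

theorem wt_add (s t : ℝ) (k : ℕ) : wt (s + t) k = wt s k * wt t k := by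
  rcases Nat.eq_zero_or_pos k with rfl | hk
  · simp [wt]
  · rw [wt_of_pos hk, wt_of_pos hk, wt_of_pos hk]
    exact Real.rpow_add (by exact_mod_cast hk) s t

theorem wt_mono {s : ℝ} (hs : 0 ≤ s) {j k : ℕ} (h : j ≤ k) : wt s j ≤ wt s k := by
  rcases Nat.eq_zero_or_pos j with rfl | hj
  · simpa [wt] using one_le_wt hs k
  · rw [wt_of_pos hj, wt_of_pos (hj.trans_le h)]
    exact Real.rpow_le_rpow (by positivity) (by exact_mod_cast h) hs

theorem wt_succ_le {s : ℝ} (hs : 0 ≤ s) (k : ℕ) : wt s (k + 1) ≤ 2 ^ s * wt s k := by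
  rcases Nat.eq_zero_or_pos k with rfl | hk
  · simpa [wt] using Real.one_le_rpow one_le_two hs
  · rw [wt_of_pos k.succ_pos, wt_of_pos hk, ← Real.mul_rpow zero_le_two (Nat.cast_nonneg k)]
    refine Real.rpow_le_rpow (Nat.cast_nonneg _) ?_ hs
    have : k + 1 ≤ 2 * k := by omega
    exact_mod_cast this

/-! ## Elements of `Ω^s` -/

theorem Omega.seq_mk {s : ℝ} (x : ℕ → ℝ) (hx : MemOmega s x) : (Omega.mk x hx).seq = x := rfl

theorem Omega.seq_add {s : ℝ} (x y : Omega s) : (x + y).seq = x.seq + y.seq := rfl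

theorem Omega.seq_sub {s : ℝ} (x y : Omega s) : (x - y).seq = x.seq - y.seq := rfl

theorem Omega.seq_smul {s : ℝ} (c : ℝ) (x : Omega s) : (c • x).seq = c • x.seq := rfl

theorem Omega.abs_seq_mul_wt_le {s : ℝ} (x : Omega s) (k : ℕ) : |x.seq k| * wt s k ≤ ‖x‖ :=
  le_omegaNorm x.mem k

theorem Omega.norm_le {s : ℝ} {x : Omega s} {C : ℝ} (h : ∀ k, |x.seq k| * wt s k ≤ C) : ‖x‖ ≤ C :=
  ciSup_le h

theorem Omega.abs_seq_le {s : ℝ} {x : Omega s} {r : ℝ} (h : ‖x‖ ≤ r) (k : ℕ) :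
    |x.seq k| ≤ r / wt s k := by
  rw [le_div_iff₀ (wt_pos s k)]
  exact (x.abs_seq_mul_wt_le k).trans h

theorem omegaNorm_nonneg (s : ℝ) (x : ℕ → ℝ) : 0 ≤ omegaNorm s x :=
  Real.iSup_nonneg fun k => mul_nonneg (abs_nonneg _) (wt_pos s k).le

theorem MemOmega.abs_le {s : ℝ} {x : ℕ → ℝ} (hx : MemOmega s x) (k : ℕ) :
    |x k| ≤ omegaNorm s x / wt s k := by
  rw [le_div_iff₀ (wt_pos s k)]
  exact le_omegaNorm hx k

theorem memOmega_of_abs_le {s C : ℝ} {x : ℕ → ℝ} (h : ∀ k, |x k| ≤ C / wt s k) : MemOmega s x :=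
  memOmega_iff.2 ⟨C, fun k => (le_div_iff₀ (wt_pos s k)).1 (h k)⟩

theorem MemOmega.add {s : ℝ} {x y : ℕ → ℝ} (hx : MemOmega s x) (hy : MemOmega s y) :
    MemOmega s (x + y) := (omegaSubmodule s).add_mem hx hy

theorem MemOmega.sub {s : ℝ} {x y : ℕ → ℝ} (hx : MemOmega s x) (hy : MemOmega s y) :
    MemOmega s (x - y) := (omegaSubmodule s).sub_mem hx hy

/-- A linear and bounded operation on sequences, as a continuous linear map `Ω^s → Ω^t`. -/
noncomputable def Omega.clm {s t : ℝ} (G : Omega s →ₗ[ℝ] (ℕ → ℝ)) (C : ℝ)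
    (h : ∀ x k, |G x k| * wt t k ≤ C * ‖x‖) : Omega s →L[ℝ] Omega t :=
  LinearMap.mkContinuous
    { toFun := fun x => Omega.mk (G x) (memOmega_iff.2 ⟨_, h x⟩)
      map_add' := fun x y => Omega.ext fun k => congrFun (G.map_add x y) k
      map_smul' := fun c x => Omega.ext fun k => congrFun (G.map_smul c x) k } C
    fun x => Omega.norm_le (h x)

/-- The inclusion of `Ω^s` in `Ω^t` for `t ≤ s`. -/
noncomputable def Omega.incl {s t : ℝ} (h : t ≤ s) : Omega s →L[ℝ] Omega t :=
  Omega.clm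
    { toFun := Omega.seq
      map_add' := fun _ _ => rfl
      map_smul' := fun _ _ => rfl } 1 fun x k => by
        rw [one_mul]
        exact (mul_le_mul_of_nonneg_left (wt_le_wt_of_exponent_le h k) (abs_nonneg _)).trans
          (x.abs_seq_mul_wt_le k)

/-- The evaluation of a sequence in `Ω^s` at an index. -/
noncomputable def Omega.coord (s : ℝ) (k : ℕ) : Omega s →L[ℝ] ℝ :=
  LinearMap.mkContinuous
    { toFun := fun x => x.seq k
      map_add' := fun _ _ => rfl
      map_smul' := fun _ _ => rfl } (1 / wt s k) fun x => by
        rw [one_div, inv_mul_eq_div]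
        exact Omega.abs_seq_le le_rfl k

/-! ## The convolution estimate -/

theorem summable_one_div_succ_rpow {s : ℝ} (hs : 1 < s) :
    Summable fun n : ℕ => 1 / ((n : ℝ) + 1) ^ s := by
  have := (summable_nat_add_iff 1).2 (Real.summable_one_div_nat_rpow.2 hs)
  simpa using this

/-- The first `N` terms are kept and the others are compared with the integral of `x^{-s}` from `N`.
Twice the right-hand side is the constant `S`. -/
theorem tsum_one_div_succ_rpow_le {s : ℝ} (hs : 1 < s) {N : ℕ} (hN : 1 ≤ N) :
    ∑' n : ℕ, 1 / ((n : ℝ) + 1) ^ s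
      ≤ ∑ l ∈ Finset.Icc 1 N, 1 / (l : ℝ) ^ s + 1 / ((s - 1) * (N : ℝ) ^ (s - 1)) := by
  have hN0 : (0 : ℝ) < N := by exact_mod_cast hN
  have hpos : ∀ n : ℕ, 0 ≤ 1 / ((n : ℝ) + 1) ^ s := fun n => by positivity
  refine Real.tsum_le_of_sum_range_le hpos fun n => ?_
  have h1 : ∑ i ∈ Finset.range n, 1 / ((i : ℝ) + 1) ^ s
      ≤ ∑ i ∈ Finset.range (N + n), 1 / ((i : ℝ) + 1) ^ s :=
    Finset.sum_le_sum_of_subset_of_nonneg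
      (Finset.range_subset_range.2 (Nat.le_add_left n N)) fun i _ _ => hpos i
  have h2 : ∑ i ∈ Finset.range N, 1 / ((i : ℝ) + 1) ^ s
      = ∑ l ∈ Finset.Icc 1 N, 1 / (l : ℝ) ^ s := by
    rw [Finset.range_eq_Ico, Finset.sum_Ico_add' (fun l : ℕ => 1 / (l : ℝ) ^ s) 0 N 1 |>.symm.trans
      (Finset.sum_congr rfl fun i _ => by push_cast; rfl) |>.symm]
    rfl
  have h3 : ∑ i ∈ Finset.range n, 1 / (((N + i : ℕ) : ℝ) + 1) ^ s
      ≤ ∫ x in (N : ℝ)..(N : ℝ) + n, x ^ (-s) := by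
    have := AntitoneOn.sum_le_integral (f := fun x : ℝ => x ^ (-s)) (x₀ := (N : ℝ)) (a := n) ?_
    · refine le_trans (le_of_eq (Finset.sum_congr rfl fun i _ => ?_)) this
      rw [Real.rpow_neg (by positivity), one_div]
      push_cast
      rw [add_assoc]
    · intro x hx y hy hxy
      exact Real.rpow_le_rpow_of_nonpos (hN0.trans_le hx.1) hxy (by linarith)
  rw [integral_rpow (Or.inr ⟨by linarith, by
    rw [Set.uIcc_of_le (by linarith [(Nat.cast_nonneg n : (0 : ℝ) ≤ n)])]
    exact fun h => absurd h.1 (not_le.2 hN0)⟩)] at h3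
  have h4 : (((N : ℝ) + n) ^ (-s + 1) - (N : ℝ) ^ (-s + 1)) / (-s + 1)
      ≤ 1 / ((s - 1) * (N : ℝ) ^ (s - 1)) := by
    have e : (N : ℝ) ^ (-s + 1) = ((N : ℝ) ^ (s - 1))⁻¹ := by
      rw [← Real.rpow_neg hN0.le, neg_sub, neg_add_eq_sub]
    have hX : 0 ≤ ((N : ℝ) + n) ^ (-s + 1) := by positivity
    rw [e, one_div, mul_inv, inv_mul_eq_div, ← neg_div_neg_eq, show -(-s + 1) = s - 1 by ring]
    exact div_le_div_of_nonneg_right (by linarith) (by linarith)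
  rw [Finset.sum_range_add] at h1
  linarith

theorem sum_one_div_Icc_le_log {n : ℕ} (hn : 1 ≤ n) :
    ∑ l ∈ Finset.Icc 2 n, 1 / (l : ℝ) ≤ Real.log n := by
  have h := harmonic_le_one_add_log n
  rw [harmonic_eq_sum_Icc, ← Finset.add_sum_Ioc_eq_sum_Icc hn] at h
  push_cast at h
  have e : Finset.Icc 2 n = Finset.Ioc 1 n := rfl
  simp only [e, one_div]
  norm_num at h
  linarith

theorem sum_one_div_sq_Icc_le (n : ℕ) :
    ∑ l ∈ Finset.Icc 2 n, 1 / (l : ℝ) ^ 2 ≤ Real.pi ^ 2 / 6 - 1 := by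
  have h := hasSum_zeta_two.summable.sum_le_tsum (insert 1 (Finset.Icc 2 n)) fun i _ => by positivity
  rw [hasSum_zeta_two.tsum_eq, Finset.sum_insert (by simp)] at h
  norm_num at h ⊢
  linarith

/-- Since `log (k-1) ≤ log (k-2) + 1/(k-2)`, it suffices that `k/(k-2) ≤ log (k-2)`. This holds from
`k = 7` on, where `7/5` separates the two sides, but fails at `k = 6`; that case rests on `5^6 ≤
4^7`. -/
theorem log_sub_two_div_succ_le {k : ℕ} (hk : 6 ≤ k) :
    Real.log (((k + 1 : ℕ) : ℝ) - 2) / ((k + 1 : ℕ) : ℝ) ≤ Real.log ((k : ℝ) - 2) / k := by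
  have hk' : (6 : ℝ) ≤ k := by exact_mod_cast hk
  rw [div_le_div_iff₀ (by positivity) (by positivity)]
  push_cast
  rcases hk.eq_or_lt with rfl | h7
  · norm_num
    have : Real.log ((5 : ℝ) ^ 6) ≤ Real.log ((4 : ℝ) ^ 7) :=
      Real.log_le_log (by positivity) (by norm_num)
    rw [Real.log_pow, Real.log_pow] at this
    push_cast at this
    linarith
  · have h7' : (7 : ℝ) ≤ k := by exact_mod_cast h7
    have h5 : (7 / 5 : ℝ) ≤ Real.log ((k : ℝ) - 2) := by
      refine le_trans ?_ (Real.log_le_log (by norm_num : (0 : ℝ) < 5) (by linarith))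
      have h : Real.log (Real.exp 1 ^ 7) ≤ Real.log ((5 : ℝ) ^ 5) := by
        refine Real.log_le_log (by positivity) ?_
        have : Real.exp 1 ^ 7 ≤ (2.7182818286 : ℝ) ^ 7 :=
          pow_le_pow_left₀ (Real.exp_pos 1).le Real.exp_one_lt_d9.le 7
        exact this.trans (by norm_num)
      rw [Real.log_pow, Real.log_pow, Real.log_exp] at h
      push_cast at h
      linarith
    have hd : Real.log ((k : ℝ) + 1 - 2) ≤ Real.log ((k : ℝ) - 2) + 1 / ((k : ℝ) - 2) := by
      have h1 : (k : ℝ) + 1 - 2 = ((k : ℝ) - 2) * (1 + 1 / ((k : ℝ) - 2)) := by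
        have : (k : ℝ) - 2 ≠ 0 := by linarith
        field_simp
        ring
      have hp : 0 < 1 / ((k : ℝ) - 2) := by
        apply one_div_pos.2; linarith
      rw [h1, Real.log_mul (by linarith) (by linarith)]
      have := Real.log_le_sub_one_of_pos (by linarith : 0 < 1 + 1 / ((k : ℝ) - 2))
      linarith
    have hq : (k : ℝ) * (1 / ((k : ℝ) - 2)) ≤ 7 / 5 := by
      rw [mul_one_div, div_le_div_iff₀ (by linarith) (by norm_num)]
      linarith
    nlinarith

theorem log_sub_two_div_le {m k : ℕ} (hm : 6 ≤ m) (hk : m ≤ k) :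
    Real.log ((k : ℝ) - 2) / k ≤ Real.log ((m : ℝ) - 2) / m := by
  induction k, hk using Nat.le_induction with
  | base => exact le_rfl
  | succ n hn ih => exact (log_sub_two_div_succ_le (hm.trans hn)).trans ih

theorem sum_Icc_reflect (F : ℕ → ℝ) {k : ℕ} :
    ∑ l ∈ Finset.Icc 2 (k - 2), F (k - l) = ∑ l ∈ Finset.Icc 2 (k - 2), F l := by
  refine Finset.sum_nbij' (fun l => k - l) (fun l => k - l) ?_ ?_ ?_ ?_ ?_ <;>
    intro l hl <;> simp only [Finset.mem_Icc] at hl ⊢ <;> omega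

/-- The cross term of the square is `2/(l(k-l)) = (2/k)(1/l + 1/(k-l))`, and reflection merges the
sums over `l` and `k - l`. The squares give `2(π²/6 - 1)`, the cross terms at most `4 log(k-2)/k`,
which is largest at `k = m`. -/
theorem sum_Icc_sq_inv_add_inv_le {m k : ℕ} (hm : 6 ≤ m) (hk : m ≤ k) :
    ∑ l ∈ Finset.Icc 2 (k - 2), (1 / (l : ℝ) + 1 / ((k : ℝ) - l)) ^ 2
      ≤ 4 * Real.log ((m : ℝ) - 2) / m + (Real.pi ^ 2 - 6) / 3 := by
  have hk0 : (6 : ℝ) ≤ k := by exact_mod_cast hm.trans hk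
  have e : ∀ l ∈ Finset.Icc 2 (k - 2), (1 / (l : ℝ) + 1 / ((k : ℝ) - l)) ^ 2
      = 1 / (l : ℝ) ^ 2 + 1 / ((k - l : ℕ) : ℝ) ^ 2
        + 2 / (k : ℝ) * (1 / (l : ℝ) + 1 / ((k - l : ℕ) : ℝ)) := by
    intro l hl
    rw [Finset.mem_Icc] at hl
    have hl0 : (l : ℝ) ≠ 0 := by
      have : l ≠ 0 := by omega
      exact_mod_cast this
    have hlk : (k : ℝ) - l ≠ 0 := by
      have : l < k := by omega
      have : (l : ℝ) < k := by exact_mod_cast this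
      linarith
    rw [Nat.cast_sub (by omega)]
    field_simp
    ring
  rw [Finset.sum_congr rfl e, Finset.sum_add_distrib, Finset.sum_add_distrib, ← Finset.mul_sum,
    Finset.sum_add_distrib, sum_Icc_reflect (fun l => 1 / (l : ℝ) ^ 2),
    sum_Icc_reflect (fun l => 1 / (l : ℝ))]
  have h1 := sum_one_div_sq_Icc_le (k - 2)
  have h2 := sum_one_div_Icc_le_log (n := k - 2) (by omega)
  rw [Nat.cast_sub (by omega)] at h2
  push_cast at h2
  have h3 := log_sub_two_div_le hm hk
  have h4 : 2 / (k : ℝ) * (∑ l ∈ Finset.Icc 2 (k - 2), 1 / (l : ℝ)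
      + ∑ l ∈ Finset.Icc 2 (k - 2), 1 / (l : ℝ)) ≤ 4 * (Real.log ((k : ℝ) - 2) / k) := by
    calc _ ≤ 2 / (k : ℝ) * (Real.log ((k : ℝ) - 2) + Real.log ((k : ℝ) - 2)) := by gcongr
      _ = _ := by ring
  rw [mul_div_assoc]
  linarith

/-- The end terms `l = 1` and `l = k - 1` are split off. In the others the base `k/(l(k-l)) = 1/l +
1/(k-l)` is at most `2/m + 1/2`; two powers are kept for the summation and the remaining `s - 2` are
bounded uniformly. -/
theorem sum_Icc_rpow_le {s : ℝ} (hs : 2 ≤ s) {m k : ℕ} (hm : 6 ≤ m) (hk : m ≤ k) :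
    ∑ l ∈ Finset.Icc 1 (k - 1), (k : ℝ) ^ s / ((l : ℝ) ^ s * ((k : ℝ) - l) ^ s)
      ≤ 2 * ((m : ℝ) / ((m : ℝ) - 1)) ^ s
        + (4 * Real.log ((m : ℝ) - 2) / m + (Real.pi ^ 2 - 6) / 3)
          * (2 / (m : ℝ) + 1 / 2) ^ (s - 2) := by
  have hm' : (6 : ℝ) ≤ m := by exact_mod_cast hm
  have hk' : (m : ℝ) ≤ k := by exact_mod_cast hk
  have hset : Finset.Icc 1 (k - 1) = insert 1 (insert (k - 1) (Finset.Icc 2 (k - 2))) := by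
    ext l
    simp only [Finset.mem_insert, Finset.mem_Icc]
    omega
  have hq : (k : ℝ) / ((k : ℝ) - 1) ≤ (m : ℝ) / ((m : ℝ) - 1) := by
    rw [div_le_div_iff₀ (by linarith) (by linarith)]
    linarith
  have hend : (k : ℝ) ^ s / ((k : ℝ) - 1) ^ s ≤ ((m : ℝ) / ((m : ℝ) - 1)) ^ s := by
    rw [← Real.div_rpow (by linarith) (by linarith)]
    exact Real.rpow_le_rpow (div_nonneg (by linarith) (by linarith)) hq (by linarith)
  have hmid : ∀ l ∈ Finset.Icc 2 (k - 2), (k : ℝ) ^ s / ((l : ℝ) ^ s * ((k : ℝ) - l) ^ s)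
      ≤ (1 / (l : ℝ) + 1 / ((k : ℝ) - l)) ^ 2 * (2 / (m : ℝ) + 1 / 2) ^ (s - 2) := by
    intro l hl
    rw [Finset.mem_Icc] at hl
    have hl2 : (2 : ℝ) ≤ l := by exact_mod_cast hl.1
    have hlk : (l : ℝ) + 2 ≤ k := by
      have : l + 2 ≤ k := by omega
      exact_mod_cast this
    have hx : (k : ℝ) / ((l : ℝ) * ((k : ℝ) - l)) = 1 / (l : ℝ) + 1 / ((k : ℝ) - l) := by
      have : (k : ℝ) - l ≠ 0 := by linarith
      have : (l : ℝ) ≠ 0 := by linarith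
      field_simp
      ring
    have hx0 : 0 < (k : ℝ) / ((l : ℝ) * ((k : ℝ) - l)) :=
      div_pos (by linarith) (mul_pos (by linarith) (by linarith))
    have hxle : (k : ℝ) / ((l : ℝ) * ((k : ℝ) - l)) ≤ 2 / (m : ℝ) + 1 / 2 := by
      have h1 : 2 * ((k : ℝ) - 2) ≤ (l : ℝ) * ((k : ℝ) - l) := by nlinarith
      calc (k : ℝ) / ((l : ℝ) * ((k : ℝ) - l)) ≤ k / (2 * ((k : ℝ) - 2)) := by
            gcongr
            linarith
        _ ≤ (4 + m) / (2 * m) := by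
            rw [div_le_div_iff₀ (by linarith) (by linarith)]
            nlinarith
        _ = 2 / (m : ℝ) + 1 / 2 := by
            field_simp
            ring
    rw [← Real.mul_rpow (by linarith) (by linarith), ← Real.div_rpow (by linarith)
      (mul_nonneg (by linarith) (by linarith)), ← hx]
    calc ((k : ℝ) / ((l : ℝ) * ((k : ℝ) - l))) ^ s
        = ((k : ℝ) / ((l : ℝ) * ((k : ℝ) - l))) ^ 2
          * ((k : ℝ) / ((l : ℝ) * ((k : ℝ) - l))) ^ (s - 2) := by
          rw [← Real.rpow_natCast _ 2, ← Real.rpow_add hx0]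
          congr 1
          push_cast
          ring
      _ ≤ _ := mul_le_mul_of_nonneg_left
          (Real.rpow_le_rpow hx0.le hxle (by linarith)) (by positivity)
  rw [hset, Finset.sum_insert (by simp; omega), Finset.sum_insert (by simp; omega)]
  have hsum := (Finset.sum_le_sum hmid).trans_eq (Finset.sum_mul _ _ _).symm
  have hsum' := hsum.trans (mul_le_mul_of_nonneg_right (sum_Icc_sq_inv_add_inv_le hm hk)
    (Real.rpow_nonneg (by positivity) _))
  rw [Nat.cast_sub (by omega)]
  push_cast
  rw [Real.one_rpow, one_mul, sub_sub_cancel, Real.one_rpow, mul_one]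
  linarith

/-- The terms of the convolution of the sequence `1 / ω^s` with itself. -/
noncomputable def convKernel (s : ℝ) (k : ℕ) (j : ℤ) : ℝ :=
  1 / wt s j.natAbs * (1 / wt s ((k : ℤ) - j).natAbs)

theorem convKernel_nonneg (s : ℝ) (k : ℕ) (j : ℤ) : 0 ≤ convKernel s k j :=
  mul_nonneg (one_div_nonneg.2 (wt_pos _ _).le) (one_div_nonneg.2 (wt_pos _ _).le)

theorem summable_one_div_wt {s : ℝ} (hs : 1 < s) : Summable fun n : ℕ => 1 / wt s n := by
  rw [← summable_nat_add_iff 1]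
  refine (summable_one_div_succ_rpow hs).congr fun n => ?_
  rw [wt_of_pos n.succ_pos]
  push_cast
  rfl

theorem summable_one_div_wt_natAbs {s : ℝ} (hs : 1 < s) :
    Summable fun j : ℤ => 1 / wt s j.natAbs := by
  refine Summable.of_nat_of_neg ?_ ?_ <;> simpa using summable_one_div_wt hs

theorem summable_convKernel {s : ℝ} (hs : 1 < s) (k : ℕ) : Summable (convKernel s k) := by
  refine Summable.of_nonneg_of_le (convKernel_nonneg s k) (fun j => ?_)
    (summable_one_div_wt_natAbs hs)
  have h := one_le_wt (by linarith : 0 ≤ s) ((k : ℤ) - j).natAbs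
  exact mul_le_of_le_one_right (one_div_nonneg.2 (wt_pos _ _).le)
    (by rw [div_le_one (wt_pos _ _)]; exact h)

/-- The reflection `j ↦ k - j` exchanges the ranges `j < 0` and `j > k`, hence the factor `2`. -/
theorem tsum_convKernel_eq {s : ℝ} (hs : 1 < s) (k : ℕ) :
    ∑' j, convKernel s k j
      = ∑ l ∈ Finset.range (k + 1), 1 / wt s l * (1 / wt s (k - l))
        + 2 * ∑' n : ℕ, 1 / wt s (n + 1) * (1 / wt s (k + (n + 1))) := by
  have h := summable_convKernel hs k
  have hi : Function.Injective fun n : ℕ => -((n : ℤ) + 1) := fun a b h => by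
    simpa using h
  have h1 : Summable fun n : ℕ => convKernel s k n := h.comp_injective Nat.cast_injective
  rw [tsum_of_nat_of_neg_add_one h1 (h.comp_injective hi), ← h1.sum_add_tsum_nat_add (k + 1)]
  have e1 : ∀ l ∈ Finset.range (k + 1), convKernel s k l = 1 / wt s l * (1 / wt s (k - l)) := by
    intro l hl
    rw [Finset.mem_range] at hl
    unfold convKernel
    rw [Int.natAbs_natCast, show ((k : ℤ) - (l : ℤ)).natAbs = k - l by omega]
  have e2 : ∀ n : ℕ, convKernel s k ((n + (k + 1) : ℕ) : ℤ)
      = 1 / wt s (n + 1) * (1 / wt s (k + (n + 1))) := by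
    intro n
    unfold convKernel
    rw [Int.natAbs_natCast, show ((k : ℤ) - ((n + (k + 1) : ℕ) : ℤ)).natAbs = n + 1 by omega,
      mul_comm, show n + (k + 1) = k + (n + 1) by omega]
  have e3 : ∀ n : ℕ, convKernel s k (-((n : ℤ) + 1))
      = 1 / wt s (n + 1) * (1 / wt s (k + (n + 1))) := by
    intro n
    unfold convKernel
    rw [show (-((n : ℤ) + 1)).natAbs = n + 1 by omega,
      show ((k : ℤ) - -((n : ℤ) + 1)).natAbs = k + (n + 1) by omega]
  rw [Finset.sum_congr rfl e1, tsum_congr e2, tsum_congr e3]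
  ring

theorem tsum_one_div_wt_mul_le {s : ℝ} (hs : 1 < s) (k : ℕ) :
    ∑' n : ℕ, 1 / wt s (n + 1) * (1 / wt s (k + (n + 1)))
      ≤ (∑' n : ℕ, 1 / ((n : ℝ) + 1) ^ s) * (1 / wt s k) := by
  have hle : ∀ n : ℕ, 1 / wt s (n + 1) * (1 / wt s (k + (n + 1)))
      ≤ 1 / ((n : ℝ) + 1) ^ s * (1 / wt s k) := by
    intro n
    have e : wt s (n + 1) = ((n : ℝ) + 1) ^ s := by
      rw [wt_of_pos n.succ_pos]
      push_cast
      rfl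
    rw [e]
    exact mul_le_mul_of_nonneg_left
      (one_div_le_one_div_of_le (wt_pos _ _) (wt_mono (by linarith) (Nat.le_add_right _ _)))
      (by positivity)
  have hs2 := (summable_one_div_succ_rpow hs).mul_right (1 / wt s k)
  rw [← tsum_mul_right]
  exact (Summable.of_nonneg_of_le (fun n => mul_nonneg (one_div_nonneg.2 (wt_pos _ _).le)
    (one_div_nonneg.2 (wt_pos _ _).le)) hle hs2).tsum_le_tsum hle hs2

theorem tsum_convKernel_le {s : ℝ} (hs : 2 ≤ s) {m N : ℕ} (hm : 6 ≤ m) (hN : 1 ≤ N) (k : ℕ) :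
    ∑' j, convKernel s k j ≤ alpha s m N k / wt s k := by
  have hs1 : 1 < s := by linarith
  rw [tsum_convKernel_eq hs1]
  have h1 := tsum_one_div_wt_mul_le hs1 k
  have h2 := tsum_one_div_succ_rpow_le hs1 hN
  have hz : 2 * ∑' n : ℕ, 1 / wt s (n + 1) * (1 / wt s (k + (n + 1)))
      ≤ (2 * ∑ l ∈ Finset.Icc 1 N, 1 / (l : ℝ) ^ s + 2 / ((s - 1) * (N : ℝ) ^ (s - 1)))
        / wt s k := by
    refine (mul_le_mul_of_nonneg_left (h1.trans (mul_le_mul_of_nonneg_right h2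
      (one_div_nonneg.2 (wt_pos s k).le))) zero_le_two).trans_eq ?_
    ring
  rcases Nat.eq_zero_or_pos k with rfl | hk
  · have hw : wt s 0 = 1 := if_pos rfl
    rw [hw] at hz
    simp only [alpha, if_pos, zero_add, Finset.sum_range_one, hw, Nat.sub_self]
    simp only [zero_add] at hz
    linarith
  · have hk0 : (0 : ℝ) < k := by exact_mod_cast hk
    have hfin : ∑ l ∈ Finset.range (k + 1), 1 / wt s l * (1 / wt s (k - l))
        = (2 + ∑ l ∈ Finset.Icc 1 (k - 1), (k : ℝ) ^ s / ((l : ℝ) ^ s * ((k : ℝ) - l) ^ s))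
          / wt s k := by
      have hset : Finset.range (k + 1) = insert 0 (insert k (Finset.Icc 1 (k - 1))) := by
        ext l
        simp only [Finset.mem_insert, Finset.mem_Icc, Finset.mem_range]
        omega
      rw [hset, Finset.sum_insert (by simp; omega), Finset.sum_insert (by simp; omega), add_div,
        Finset.sum_div]
      have hw : wt s 0 = 1 := if_pos rfl
      rw [Nat.sub_self, Nat.sub_zero, hw, ← add_assoc]
      congr 1
      · ring
      · refine Finset.sum_congr rfl fun l hl => ?_
        rw [Finset.mem_Icc] at hl
        rw [wt_of_pos hk, wt_of_pos hl.1, wt_of_pos (by omega : 0 < k - l), Nat.cast_sub (by omega)]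
        have : (k : ℝ) ^ s ≠ 0 := (Real.rpow_pos_of_pos hk0 s).ne'
        field_simp
    rw [hfin]
    refine (add_le_add_right hz _).trans ?_
    rw [← add_div]
    refine div_le_div_of_nonneg_right ?_ (wt_pos s k).le
    unfold alpha
    rw [if_neg hk.ne']
    split_ifs with hkm
    · linarith
    · have := sum_Icc_rpow_le hs hm (not_lt.1 hkm)
      linarith

theorem alpha_of_le {s : ℝ} {m N k : ℕ} (hm : 0 < m) (hk : m ≤ k) :
    alpha s m N k = alpha s m N m := by
  unfold alpha
  rw [if_neg (by omega), if_neg (by omega), if_neg hm.ne', if_neg (lt_irrefl m)]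

theorem exists_alpha_le (s : ℝ) {m : ℕ} (N : ℕ) (hm : 0 < m) :
    ∃ C, 0 < C ∧ ∀ k, alpha s m N k ≤ C := by
  refine ⟨1 + ∑ i ∈ Finset.range (m + 1), |alpha s m N i|, by positivity, fun k => ?_⟩
  have hmem : ∀ i ∈ Finset.range (m + 1),
      alpha s m N i ≤ 1 + ∑ i ∈ Finset.range (m + 1), |alpha s m N i| := by
    intro i hi
    have h := Finset.single_le_sum (f := fun i => |alpha s m N i|) (fun j _ => abs_nonneg _) hi
    have := le_abs_self (alpha s m N i)
    linarith
  rcases le_total m k with h | h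
  · rw [alpha_of_le hm h]
    exact hmem m (Finset.self_mem_range_succ m)
  · exact hmem k (Finset.mem_range.2 (by omega))

/-! ### The convolution as a bounded bilinear map -/

theorem abs_conv_term_le {s : ℝ} {x y : ℕ → ℝ} {X Y : ℝ} (hx : ∀ k, |x k| ≤ X / wt s k)
    (hy : ∀ k, |y k| ≤ Y / wt s k) (k : ℕ) (j : ℤ) :
    |x j.natAbs * y ((k : ℤ) - j).natAbs| ≤ X * Y * convKernel s k j := by
  rw [abs_mul]
  refine (mul_le_mul (hx _) (hy _) (abs_nonneg _) ((abs_nonneg _).trans (hx _))).trans_eq ?_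
  unfold convKernel
  ring

theorem summable_conv_of_le {s : ℝ} (hs : 1 < s) {x y : ℕ → ℝ} {X Y : ℝ}
    (hx : ∀ k, |x k| ≤ X / wt s k) (hy : ∀ k, |y k| ≤ Y / wt s k) (k : ℕ) :
    Summable fun j : ℤ => x j.natAbs * y ((k : ℤ) - j).natAbs :=
  Summable.of_norm_bounded ((summable_convKernel hs k).mul_left (X * Y))
    fun j => abs_conv_term_le hx hy k j

theorem summable_conv {s : ℝ} (hs : 1 < s) {x y : ℕ → ℝ} (hx : MemOmega s x) (hy : MemOmega s y)
    (k : ℕ) : Summable fun j : ℤ => x j.natAbs * y ((k : ℤ) - j).natAbs :=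
  summable_conv_of_le hs hx.abs_le hy.abs_le k

/-- The convolution estimate. -/
theorem abs_conv_le {s : ℝ} (hs : 2 ≤ s) {m N : ℕ} (hm : 6 ≤ m) (hN : 1 ≤ N) {x y : ℕ → ℝ}
    {X Y : ℝ} (hx : ∀ k, |x k| ≤ X / wt s k) (hy : ∀ k, |y k| ≤ Y / wt s k) (k : ℕ) :
    |conv x y k| ≤ alpha s m N k * (X * Y) / wt s k := by
  have hX : 0 ≤ X := by simpa [wt] using (abs_nonneg _).trans (hx 0)
  have hY : 0 ≤ Y := by simpa [wt] using (abs_nonneg _).trans (hy 0)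
  have hs1 : 1 < s := by linarith
  have h : |conv x y k| ≤ ∑' j, X * Y * convKernel s k j := by
    rw [conv, ← Real.norm_eq_abs]
    exact tsum_of_norm_bounded ((summable_convKernel hs1 k).mul_left (X * Y)).hasSum
      fun j => abs_conv_term_le hx hy k j
  refine h.trans ?_
  rw [tsum_mul_left]
  refine (mul_le_mul_of_nonneg_left (tsum_convKernel_le hs hm hN k)
    (mul_nonneg hX hY)).trans_eq ?_
  ring

theorem conv_comm (x y : ℕ → ℝ) : conv x y = conv y x := by
  funext k
  unfold conv
  rw [← (Equiv.subLeft (k : ℤ)).tsum_eq]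
  refine tsum_congr fun j => ?_
  simp only [Equiv.subLeft_apply, sub_sub_cancel]
  ring

theorem conv_add_left {s : ℝ} (hs : 1 < s) {x x' y : ℕ → ℝ} (hx : MemOmega s x)
    (hx' : MemOmega s x') (hy : MemOmega s y) : conv (x + x') y = conv x y + conv x' y := by
  funext k
  simp only [conv, Pi.add_apply, add_mul]
  exact (summable_conv hs hx hy k).tsum_add (summable_conv hs hx' hy k)

theorem conv_smul_left (c : ℝ) (x y : ℕ → ℝ) : conv (c • x) y = c • conv x y := by
  funext k
  simp only [conv, Pi.smul_apply, smul_eq_mul, mul_assoc]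
  exact tsum_mul_left

theorem memOmega_conv {s : ℝ} (hs : 2 ≤ s) {x y : ℕ → ℝ} (hx : MemOmega s x)
    (hy : MemOmega s y) : MemOmega s (conv x y) := by
  -- Only finiteness matters here, so the smallest admissible parameters of `alpha` are used.
  obtain ⟨C, hC0, hC⟩ := exists_alpha_le s (m := 6) 1 (by norm_num)
  refine memOmega_of_abs_le (C := C * (omegaNorm s x * omegaNorm s y)) fun k => ?_
  refine (abs_conv_le hs le_rfl le_rfl hx.abs_le hy.abs_le k).trans ?_
  exact div_le_div_of_nonneg_right (mul_le_mul_of_nonneg_right (hC k)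
    (mul_nonneg (omegaNorm_nonneg s x) (omegaNorm_nonneg s y))) (wt_pos s k).le

theorem isBoundedBilinearMap_conv {s : ℝ} (hs : 2 ≤ s) :
    IsBoundedBilinearMap ℝ fun p : Omega s × Omega s =>
      Omega.mk (conv p.1.seq p.2.seq) (memOmega_conv hs p.1.mem p.2.mem) where
  add_left x x' y := Omega.ext fun k =>
    congrFun (conv_add_left (by linarith) x.mem x'.mem y.mem) k
  smul_left c x y := Omega.ext fun k => congrFun (conv_smul_left c x.seq y.seq) k
  add_right x y y' := Omega.ext fun k => by
    simp only [Omega.seq_mk, Omega.seq_add, Pi.add_apply]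
    rw [conv_comm, conv_add_left (by linarith) y.mem y'.mem x.mem, conv_comm x.seq,
      conv_comm x.seq]
    rfl
  smul_right c x y := Omega.ext fun k => by
    simp only [Omega.seq_mk, Omega.seq_smul, Pi.smul_apply]
    rw [conv_comm, conv_smul_left, conv_comm x.seq]
    rfl
  bound := by
    obtain ⟨C, hC0, hC⟩ := exists_alpha_le s (m := 6) 1 (by norm_num)
    refine ⟨C, hC0, fun x y => Omega.norm_le fun k => ?_⟩
    rw [Omega.seq_mk, ← le_div_iff₀ (wt_pos s k), mul_assoc]
    refine (abs_conv_le hs le_rfl le_rfl x.mem.abs_le y.mem.abs_le k).trans ?_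
    exact div_le_div_of_nonneg_right (mul_le_mul_of_nonneg_right (hC k)
      (mul_nonneg (norm_nonneg x) (norm_nonneg y))) (wt_pos s k).le

/-! ### Diagonal dominance of the tail and the constants `γ`, `θ`, `η` -/

namespace Data

variable (P : Data)

/-- The tail of the tridiagonal operator is diagonally dominant with ratio `δ < 1/2`. -/
structure TailDominant : Prop where
  delta_pos : 0 < P.delta
  delta_lt : P.delta < 1 / 2
  b_ne_zero : ∀ n, P.b (n + 1) ≠ 0
  abs_a_le : ∀ n, |P.a (n + 1)| ≤ P.delta * |P.b (n + 1)|
  abs_c_le : ∀ n, |P.c (n + 1)| ≤ P.delta * |P.b (n + 1)|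

variable {P}

theorem Assumptions.mu_pos {C2 : ℝ} {k0 : ℕ} (hA : P.Assumptions C2 k0) {k : ℕ} (hk : k0 ≤ k) :
    P.C1 * wt P.sL k ≤ |P.mu k| := by
  have h := hA.le_mu k hk
  rwa [abs_div, abs_of_pos (wt_pos _ _), le_div_iff₀ (wt_pos _ _)] at h

theorem Assumptions.mu_ne_zero {C2 : ℝ} {k0 : ℕ} (hA : P.Assumptions C2 k0) {k : ℕ}
    (hk : k0 ≤ k) : P.mu k ≠ 0 :=
  abs_pos.1 ((mul_pos hA.C1_pos (wt_pos _ _)).trans_le (hA.mu_pos hk))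

theorem Assumptions.tailDominant {C2 : ℝ} {k0 : ℕ} (hA : P.Assumptions C2 k0) (hk0 : k0 ≤ P.m) :
    P.TailDominant where
  delta_pos := hA.delta_pos
  delta_lt := hA.delta_lt
  b_ne_zero n := hA.mu_ne_zero (by omega)
  abs_a_le n := by
    have hk : k0 ≤ P.m + (n + 1) - 1 := by omega
    have h := hA.lam_ratio _ hk
    rwa [abs_div, div_le_iff₀ (abs_pos.2 (hA.mu_ne_zero hk))] at h
  abs_c_le n := by
    have hk : k0 ≤ P.m + (n + 1) - 1 := by omega
    have h := hA.beta_ratio _ hk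
    rwa [abs_div, div_le_iff₀ (abs_pos.2 (hA.mu_ne_zero hk))] at h

namespace TailDominant

variable (H : P.TailDominant)
include H

omit H in
variable (P) in
theorem gamma_pos : 0 < P.gamma := by
  unfold gamma
  positivity

/-- This is the fixed-point equation `γ = 1 - δθ` of the pivot recursion. -/
theorem gamma_sq : P.gamma ^ 2 = P.gamma - P.delta ^ 2 := by
  have h : 0 ≤ 1 / 4 - P.delta ^ 2 := by nlinarith [H.delta_pos, H.delta_lt]
  unfold gamma
  linear_combination Real.sq_sqrt h

theorem gamma_lt_one : P.gamma < 1 := by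
  nlinarith [H.gamma_sq, (gamma_pos P), H.delta_pos, mul_pos H.delta_pos H.delta_pos]

theorem delta_lt_gamma : P.delta < P.gamma := by
  have : 0 ≤ Real.sqrt (1 / 4 - P.delta ^ 2) := Real.sqrt_nonneg _
  have := H.delta_lt
  unfold gamma
  linarith

theorem theta_pos : 0 < P.theta := div_pos H.delta_pos (gamma_pos P)

theorem theta_lt_one : P.theta < 1 := (div_lt_one (gamma_pos P)).2 H.delta_lt_gamma

theorem one_sub_theta_sq_pos : 0 < 1 - P.theta ^ 2 := by
  nlinarith [H.theta_pos, H.theta_lt_one]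

omit H in
variable (P) in
theorem delta_eq : P.delta = P.theta * P.gamma := by
  unfold theta
  rw [div_mul_cancel₀ _ (gamma_pos P).ne']

theorem eta_pos : 0 < P.eta := one_div_pos.2 (mul_pos (gamma_pos P) H.one_sub_theta_sq_pos)

end TailDominant

/-! ### The pivots -/

variable (P) in
/-- The pivots `δ_{n+1} / δ_n` of the elimination. -/
noncomputable def piv (n : ℕ) : ℝ := P.dlt (n + 1) / P.dlt n

namespace TailDominant

variable (H : P.TailDominant)
include H

/-- The next pivot is `b - a (c / p)` with `p` the present one. From `|p| ≥ γ|b|` follows `|c / p| ≤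
δ/γ = θ`, so the next pivot is at least `(1 - δθ)|b| = γ|b|` for its own `b`. Nonvanishing is part
of the induction because the recursion divides by `p`. -/
theorem dlt_ne_zero_and_le_piv (n : ℕ) :
    P.dlt n ≠ 0 ∧ P.dlt (n + 1) ≠ 0 ∧ P.gamma * |P.b (n + 1)| ≤ |P.piv n| := by
  induction n with
  | zero =>
    refine ⟨one_ne_zero, H.b_ne_zero 0, ?_⟩
    simp only [piv, dlt, div_one]
    exact mul_le_of_le_one_left (abs_nonneg _) H.gamma_lt_one.le
  | succ n ih =>
    obtain ⟨h0, h1, h2⟩ := ih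
    have hg := (gamma_pos P)
    have hb := abs_pos.2 (H.b_ne_zero n)
    have hb' := abs_pos.2 (H.b_ne_zero (n + 1))
    have hp : 0 < |P.piv n| := (mul_pos hg hb).trans_le h2
    have e : P.piv (n + 1) = P.b (n + 2) - P.a (n + 2) * (P.c (n + 1) / P.piv n) := by
      simp only [piv, dlt]
      field_simp
    have hc : |P.c (n + 1) / P.piv n| ≤ P.theta := by
      rw [abs_div, div_le_iff₀ hp]
      refine (H.abs_c_le n).trans ?_
      rw [delta_eq, mul_assoc]
      exact mul_le_mul_of_nonneg_left h2 H.theta_pos.le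
    have h3 : P.gamma * |P.b (n + 2)| ≤ |P.piv (n + 1)| := by
      have h4 : |P.a (n + 2) * (P.c (n + 1) / P.piv n)| ≤ P.delta * |P.b (n + 2)| * P.theta := by
        rw [abs_mul]
        exact mul_le_mul (H.abs_a_le (n + 1)) hc (abs_nonneg _)
          (mul_nonneg H.delta_pos.le (abs_nonneg _))
      have h5 : P.delta * P.theta = 1 - P.gamma := by
        have := H.gamma_sq
        unfold theta
        field_simp
        linarith
      have h6 := abs_sub_abs_le_abs_sub (P.b (n + 2)) (P.a (n + 2) * (P.c (n + 1) / P.piv n))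
      rw [e]
      have h7 : P.delta * |P.b (n + 2)| * P.theta = |P.b (n + 2)| - P.gamma * |P.b (n + 2)| := by
        linear_combination |P.b (n + 2)| * h5
      linarith
    refine ⟨h1, fun h => ?_, h3⟩
    rw [piv, h, zero_div, abs_zero] at h3
    exact absurd h3 (not_le.2 (mul_pos hg hb'))

theorem dlt_ne_zero (n : ℕ) : P.dlt n ≠ 0 := (H.dlt_ne_zero_and_le_piv n).1

theorem le_abs_piv (n : ℕ) : P.gamma * |P.b (n + 1)| ≤ |P.piv n| :=
  (H.dlt_ne_zero_and_le_piv n).2.2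

theorem piv_ne_zero (n : ℕ) : P.piv n ≠ 0 := div_ne_zero (H.dlt_ne_zero _) (H.dlt_ne_zero _)

omit H in
theorem piv_zero : P.piv 0 = P.b 1 := by simp [piv, dlt]

theorem piv_succ (n : ℕ) :
    P.piv (n + 1) = P.b (n + 2) - P.a (n + 2) * P.c (n + 1) / P.piv n := by
  have h0 := H.dlt_ne_zero n
  have h1 := H.dlt_ne_zero (n + 1)
  simp only [piv, dlt]
  field_simp

theorem abs_div_piv_le {x : ℝ} {n : ℕ} (h : |x| ≤ P.delta * |P.b (n + 1)|) :
    |x / P.piv n| ≤ P.theta := by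
  rw [abs_div, div_le_iff₀ (abs_pos.2 (H.piv_ne_zero n))]
  refine h.trans ?_
  rw [delta_eq, mul_assoc]
  exact mul_le_mul_of_nonneg_left (H.le_abs_piv n) H.theta_pos.le

theorem abs_c_div_piv_le (n : ℕ) : |P.c (n + 1) / P.piv n| ≤ P.theta :=
  H.abs_div_piv_le (H.abs_c_le n)

theorem abs_a_div_piv_le (n : ℕ) : |P.a (n + 1) / P.piv n| ≤ P.theta :=
  H.abs_div_piv_le (H.abs_a_le n)

/-! ### The lower triangular factor -/

omit H in
theorem LIinv_zero (y : ℕ → ℝ) : P.LIinv y 0 = y 0 := by simp [LIinv]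

/-- Forward substitution: in the closed formula the term `l = 1` and the shifted terms `l ≥ 2` share
the factor `-a_{n+2}/p_n`, where `p_n` is the pivot. -/
theorem LIinv_succ (y : ℕ → ℝ) (n : ℕ) :
    P.LIinv y (n + 1) = y (n + 1) - P.a (n + 2) / P.piv n * P.LIinv y n := by
  have h0 := H.dlt_ne_zero n
  have h1 := H.dlt_ne_zero (n + 1)
  have hset : Finset.Icc 1 (n + 1) = insert 1 ((Finset.Icc 1 n).map (addRightEmbedding 1)) := by
    ext l
    simp only [Finset.map_add_right_Icc, Finset.mem_insert, Finset.mem_Icc]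
    omega
  unfold LIinv
  rw [hset, Finset.sum_insert (by simp), Finset.sum_map, mul_add, Finset.mul_sum, sub_eq_add_neg,
    neg_add, ← Finset.sum_neg_distrib]
  congr 2
  · simp only [Nat.add_sub_cancel, Finset.Icc_self, Finset.prod_singleton, pow_one, piv]
    field_simp
  · refine Finset.sum_congr rfl fun l hl => ?_
    rw [Finset.mem_Icc] at hl
    simp only [addRightEmbedding_apply, Nat.add_sub_add_right]
    rw [show n + 1 + 1 = (n + 1) + 1 from rfl, Finset.prod_Icc_succ_top (by omega)]
    simp only [piv, pow_succ]
    field_simp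

omit H in
theorem LIinv_add (y z : ℕ → ℝ) : P.LIinv (y + z) = P.LIinv y + P.LIinv z := by
  funext k
  simp only [LIinv, Pi.add_apply, mul_add, Finset.sum_add_distrib]
  ring

omit H in
theorem LIinv_smul (r : ℝ) (y : ℕ → ℝ) : P.LIinv (r • y) = r • P.LIinv y := by
  funext k
  simp only [LIinv, Pi.smul_apply, smul_eq_mul, mul_add, Finset.mul_sum]
  congr 1
  exact Finset.sum_congr rfl fun l _ => by ring

end TailDominant

variable (P) in
/-- `∑_{j ≤ n} θ^{n-j} Y_j`. -/
noncomputable def lowSum (Y : ℕ → ℝ) (n : ℕ) : ℝ :=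
  ∑ j ∈ Finset.range (n + 1), P.theta ^ (n - j) * Y j

theorem lowSum_zero (Y : ℕ → ℝ) : P.lowSum Y 0 = Y 0 := by simp [lowSum]

theorem lowSum_succ (Y : ℕ → ℝ) (n : ℕ) :
    P.lowSum Y (n + 1) = P.theta * P.lowSum Y n + Y (n + 1) := by
  unfold lowSum
  rw [Finset.sum_range_succ, Finset.mul_sum, Nat.sub_self, pow_zero, one_mul]
  congr 1
  refine Finset.sum_congr rfl fun j hj => ?_
  rw [Finset.mem_range] at hj
  rw [Nat.sub_add_comm (by omega), pow_succ]
  ring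

namespace TailDominant

variable (H : P.TailDominant)
include H

theorem lowSum_nonneg {Y : ℕ → ℝ} (hY : ∀ n, 0 ≤ Y n) (n : ℕ) : 0 ≤ P.lowSum Y n :=
  Finset.sum_nonneg fun j _ => mul_nonneg (pow_nonneg H.theta_pos.le _) (hY j)

theorem lowSum_le {Y : ℕ → ℝ} {B : ℝ} (hY : ∀ n, Y n ≤ B) (hB : 0 ≤ B) (n : ℕ) :
    P.lowSum Y n ≤ B / (1 - P.theta) := by
  have h1 : 0 < 1 - P.theta := by linarith [H.theta_lt_one]
  have hB' : B = (1 - P.theta) * (B / (1 - P.theta)) := by field_simp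
  have hq : 0 ≤ B / (1 - P.theta) := by positivity
  induction n with
  | zero =>
    rw [lowSum_zero]
    exact (hY 0).trans (by nlinarith [H.theta_pos])
  | succ n ih =>
    rw [lowSum_succ]
    have := mul_le_mul_of_nonneg_left ih H.theta_pos.le
    have := hY (n + 1)
    linarith

/-- After division by the pivots, forward substitution has multipliers of size at most `θ`, so it is
dominated by the recursion `lowSum_succ`. -/
theorem abs_LIinv_div_piv_le {y Y : ℕ → ℝ} (hy : ∀ n, |y n / P.piv n| ≤ Y n) (n : ℕ) :
    |P.LIinv y n / P.piv n| ≤ P.lowSum Y n := by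
  induction n with
  | zero =>
    rw [LIinv_zero, lowSum_zero]
    exact hy 0
  | succ n ih =>
    have e : P.LIinv y (n + 1) / P.piv (n + 1)
        = y (n + 1) / P.piv (n + 1) - P.a (n + 2) / P.piv (n + 1) * (P.LIinv y n / P.piv n) := by
      rw [H.LIinv_succ]
      ring
    rw [e, lowSum_succ]
    refine (abs_sub _ _).trans ?_
    rw [abs_mul, add_comm]
    exact add_le_add (mul_le_mul (H.abs_a_div_piv_le (n + 1)) ih (abs_nonneg _) H.theta_pos.le)
      (hy (n + 1))

end TailDominant

/-! ### The upper triangular factor -/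

variable (P) in
/-- The product of the ratios `-c_i δ_{i-1} / δ_i` for `k < i ≤ k + l`. -/
noncomputable def upCoef (k l : ℕ) : ℝ :=
  (-1) ^ l * (P.dlt k / P.dlt (k + l)) * ∏ i ∈ Finset.Icc (k + 1) (k + l), P.c i

namespace TailDominant

variable (H : P.TailDominant)
include H

theorem upCoef_zero (k : ℕ) : P.upCoef k 0 = 1 := by
  simp [upCoef, H.dlt_ne_zero k]

theorem upCoef_succ (k l : ℕ) :
    P.upCoef k (l + 1) = -(P.c (k + l + 1) / P.piv (k + l)) * P.upCoef k l := by
  have h0 := H.dlt_ne_zero (k + l)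
  have h1 := H.dlt_ne_zero (k + l + 1)
  unfold upCoef
  rw [← add_assoc, Finset.prod_Icc_succ_top (by omega), pow_succ, piv]
  field_simp

theorem abs_upCoef_le (k l : ℕ) : |P.upCoef k l| ≤ P.theta ^ l := by
  induction l with
  | zero => rw [H.upCoef_zero, abs_one, pow_zero]
  | succ l ih =>
    rw [H.upCoef_succ, abs_mul, abs_neg, pow_succ, mul_comm]
    exact mul_le_mul ih (H.abs_c_div_piv_le _) (abs_nonneg _) (pow_nonneg H.theta_pos.le _)

theorem summable_theta_pow_mul {Y : ℕ → ℝ} {B : ℝ} (hY : ∀ n, |Y n| ≤ B) :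
    Summable fun l => P.theta ^ l * Y l := by
  refine Summable.of_norm_bounded
    ((summable_geometric_of_lt_one H.theta_pos.le H.theta_lt_one).mul_right B) fun l => ?_
  rw [norm_mul, Real.norm_of_nonneg (pow_nonneg H.theta_pos.le l)]
  exact mul_le_mul_of_nonneg_left (hY l) (pow_nonneg H.theta_pos.le l)

theorem summable_upCoef_mul {x : ℕ → ℝ} {B : ℝ} (hx : ∀ n, |x n| ≤ B) (k : ℕ) :
    Summable fun l => P.upCoef k l * x l := by
  refine Summable.of_norm_bounded
    ((summable_geometric_of_lt_one H.theta_pos.le H.theta_lt_one).mul_right B) fun l => ?_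
  rw [norm_mul]
  exact mul_le_mul (H.abs_upCoef_le k l) (hx l) (abs_nonneg _) (pow_nonneg H.theta_pos.le l)

/-- The definition separates the diagonal term from the series. Merging them needs summability,
which the bound on `z n / P.piv n` provides. -/
theorem UIinv_eq_tsum {z : ℕ → ℝ} {B : ℝ} (hz : ∀ n, |z n / P.piv n| ≤ B) (k : ℕ) :
    P.UIinv z k = ∑' l, P.upCoef k l * (z (k + l) / P.piv (k + l)) := by
  rw [(H.summable_upCoef_mul (x := fun l => z (k + l) / P.piv (k + l))
    (fun n => hz (k + n)) k).tsum_eq_zero_add, H.upCoef_zero]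
  unfold UIinv
  congr 1
  · simp only [piv, add_zero]
    rw [one_mul, div_div_eq_mul_div, div_mul_eq_mul_div, mul_comm]
  · refine tsum_congr fun l => ?_
    have h0 := H.dlt_ne_zero (k + (l + 1))
    have h1 := H.dlt_ne_zero (k + (l + 1) + 1)
    simp only [upCoef, piv]
    field_simp

/-- The argument is the upper bidiagonal factor, with the pivots on its diagonal, applied to `z`.
Term `l` of the series is `u_l z_{k+l} - u_{l+1} z_{k+l+1}` with `u_l = P.upCoef k l`, so the sum
telescopes to `z k`. -/
theorem UIinv_mul_add {z : ℕ → ℝ} {B : ℝ} (hz : ∀ n, |z n| ≤ B) (k : ℕ) :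
    P.UIinv (fun n => P.piv n * z n + P.c (n + 1) * z (n + 1)) k = z k := by
  have hB : 0 ≤ B := (abs_nonneg _).trans (hz 0)
  have hdiv : ∀ n, (P.piv n * z n + P.c (n + 1) * z (n + 1)) / P.piv n
      = z n + P.c (n + 1) / P.piv n * z (n + 1) := by
    intro n
    have := H.piv_ne_zero n
    field_simp
  have hbd : ∀ n, |(P.piv n * z n + P.c (n + 1) * z (n + 1)) / P.piv n| ≤ B + 1 * B := by
    intro n
    rw [hdiv]
    refine (abs_add_le _ _).trans (add_le_add (hz n) ?_)
    rw [abs_mul]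
    exact mul_le_mul ((H.abs_c_div_piv_le n).trans H.theta_lt_one.le) (hz _) (abs_nonneg _)
      zero_le_one
  rw [H.UIinv_eq_tsum hbd]
  have hs := H.summable_upCoef_mul (x := fun l => z (k + l)) (fun n => hz (k + n)) k
  have e : ∀ l, P.upCoef k l
        * ((P.piv (k + l) * z (k + l) + P.c (k + l + 1) * z (k + l + 1)) / P.piv (k + l))
      = P.upCoef k l * z (k + l) - P.upCoef k (l + 1) * z (k + (l + 1)) := by
    intro l
    rw [hdiv, H.upCoef_succ, ← add_assoc]
    ring
  rw [tsum_congr e, hs.tsum_sub ((summable_nat_add_iff 1).2 hs), hs.tsum_eq_zero_add,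
    add_sub_cancel_right, H.upCoef_zero, one_mul, add_zero]

/-- The tail inverse inverts the tridiagonal tail. -/
theorem tailInv_tridiag {y z : ℕ → ℝ} {B : ℝ} (hz : ∀ n, |z n| ≤ B)
    (h0 : y 0 = P.b 1 * z 0 + P.c 1 * z 1)
    (hs : ∀ n, y (n + 1)
      = P.a (n + 2) * z n + P.b (n + 2) * z (n + 1) + P.c (n + 2) * z (n + 2)) (k : ℕ) :
    P.tailInv y k = z k := by
  have hL : P.LIinv y = fun n => P.piv n * z n + P.c (n + 1) * z (n + 1) := by
    funext n
    induction n with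
    | zero => rw [LIinv_zero, h0, piv_zero]
    | succ n ih =>
      have := H.piv_ne_zero n
      rw [H.LIinv_succ, hs, ih, H.piv_succ]
      field_simp
      ring
  rw [tailInv, hL]
  exact H.UIinv_mul_add hz k

theorem abs_LIinv_div_piv_le_of_le {y : ℕ → ℝ} {B : ℝ} (hy : ∀ n, |y n / P.piv n| ≤ B) (n : ℕ) :
    |P.LIinv y n / P.piv n| ≤ B / (1 - P.theta) :=
  (H.abs_LIinv_div_piv_le (Y := fun _ => B) hy n).trans
    (H.lowSum_le (fun _ => le_rfl) ((abs_nonneg _).trans (hy 0)) n)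

theorem tailInv_eq_tsum {y : ℕ → ℝ} {B : ℝ} (hy : ∀ n, |y n / P.piv n| ≤ B) (k : ℕ) :
    P.tailInv y k = ∑' l, P.upCoef k l * (P.LIinv y (k + l) / P.piv (k + l)) :=
  H.UIinv_eq_tsum (H.abs_LIinv_div_piv_le_of_le hy) k

theorem tailInv_add {y z : ℕ → ℝ} {B C : ℝ} (hy : ∀ n, |y n / P.piv n| ≤ B)
    (hz : ∀ n, |z n / P.piv n| ≤ C) : P.tailInv (y + z) = P.tailInv y + P.tailInv z := by
  funext k
  have hyz : ∀ n, |(y + z) n / P.piv n| ≤ B + C := fun n => by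
    rw [Pi.add_apply, add_div]
    exact (abs_add_le _ _).trans (add_le_add (hy n) (hz n))
  rw [Pi.add_apply, H.tailInv_eq_tsum hyz, H.tailInv_eq_tsum hy, H.tailInv_eq_tsum hz,
    ← (H.summable_upCoef_mul (fun n => H.abs_LIinv_div_piv_le_of_le hy (k + n)) k).tsum_add
      (H.summable_upCoef_mul (fun n => H.abs_LIinv_div_piv_le_of_le hz (k + n)) k)]
  refine tsum_congr fun l => ?_
  rw [LIinv_add, Pi.add_apply]
  ring

theorem tailInv_smul {y : ℕ → ℝ} {B : ℝ} (r : ℝ) (hy : ∀ n, |y n / P.piv n| ≤ B) :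
    P.tailInv (r • y) = r • P.tailInv y := by
  funext k
  have hry : ∀ n, |(r • y) n / P.piv n| ≤ |r| * B := fun n => by
    rw [Pi.smul_apply, smul_eq_mul, mul_div_assoc, abs_mul]
    exact mul_le_mul_of_nonneg_left (hy n) (abs_nonneg r)
  rw [Pi.smul_apply, H.tailInv_eq_tsum hry, H.tailInv_eq_tsum hy, smul_eq_mul, ← tsum_mul_left]
  refine tsum_congr fun l => ?_
  rw [LIinv_smul, Pi.smul_apply, smul_eq_mul]
  ring

/-- The entries of the tail inverse decay like `θ^{|k-j|}` away from the diagonal. -/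
theorem abs_tailInv_le {y Y : ℕ → ℝ} {B : ℝ} (hy : ∀ n, |y n / P.piv n| ≤ Y n)
    (hB : ∀ n, Y n ≤ B) (k : ℕ) :
    |P.tailInv y k|
      ≤ (P.lowSum Y k + ∑' l, P.theta ^ (l + 1) * Y (k + (l + 1))) / (1 - P.theta ^ 2) := by
  have hY : ∀ n, 0 ≤ Y n := fun n => (abs_nonneg _).trans (hy n)
  have hB0 : 0 ≤ B := (hY 0).trans (hB 0)
  have hp : ∀ n, |P.lowSum Y (k + n)| ≤ B / (1 - P.theta) := fun n => by
    rw [abs_of_nonneg (H.lowSum_nonneg hY _)]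
    exact H.lowSum_le hB hB0 _
  have hsp := H.summable_theta_pow_mul hp
  have hsY := H.summable_theta_pow_mul (Y := fun n => Y (k + n)) (B := B) fun n => by
    rw [abs_of_nonneg (hY _)]
    exact hB _
  have hsY' := (summable_nat_add_iff 1).2 hsY
  have hle : |P.tailInv y k| ≤ ∑' l, P.theta ^ l * P.lowSum Y (k + l) := by
    rw [H.tailInv_eq_tsum fun n => (hy n).trans (hB n), ← Real.norm_eq_abs]
    refine tsum_of_norm_bounded hsp.hasSum fun l => ?_
    rw [norm_mul]
    exact mul_le_mul (H.abs_upCoef_le k l) (H.abs_LIinv_div_piv_le hy _) (abs_nonneg _)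
      (pow_nonneg H.theta_pos.le l)
  -- Peeling off the first term and using `lowSum_succ` reproduces the series with factor `θ²`.
  -- Solving this linear equation produces the denominator `1 - θ²`.
  have hrec : ∑' l, P.theta ^ l * P.lowSum Y (k + l)
      = P.lowSum Y k + (P.theta ^ 2 * ∑' l, P.theta ^ l * P.lowSum Y (k + l)
        + ∑' l, P.theta ^ (l + 1) * Y (k + (l + 1))) := by
    rw [← tsum_mul_left, ← (hsp.mul_left (P.theta ^ 2)).tsum_add hsY', hsp.tsum_eq_zero_add,
      pow_zero, one_mul, add_zero]
    congr 1
    refine tsum_congr fun l => ?_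
    rw [← add_assoc, lowSum_succ]
    ring
  rw [le_div_iff₀ H.one_sub_theta_sq_pos]
  have := mul_le_mul_of_nonneg_right hle H.one_sub_theta_sq_pos.le
  linarith

/-! ### The first column of the tail inverse -/

omit H in
theorem abs_single_div_piv_le (n : ℕ) :
    |(Pi.single 0 1 : ℕ → ℝ) n / P.piv n| ≤ (Pi.single 0 (1 / |P.b 1|) : ℕ → ℝ) n := by
  cases n with
  | zero => simp [piv_zero]
  | succ n => simp

omit H in
theorem single_le (n : ℕ) :
    (Pi.single 0 (1 / |P.b 1|) : ℕ → ℝ) n ≤ 1 / |P.b 1| := by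
  cases n with
  | zero => simp
  | succ n => simp

omit H in
theorem lowSum_single (r : ℝ) (n : ℕ) :
    P.lowSum (Pi.single 0 r : ℕ → ℝ) n = P.theta ^ n * r := by
  induction n with
  | zero => simp [lowSum_zero]
  | succ n ih =>
    rw [lowSum_succ, ih, Pi.single_eq_of_ne n.succ_ne_zero, pow_succ]
    ring

theorem abs_w_le (k : ℕ) : |P.w k| ≤ P.eta * P.theta ^ k / |P.b 1| := by
  have h := H.abs_tailInv_le abs_single_div_piv_le single_le k
  have e : ∀ l, P.theta ^ (l + 1) * (Pi.single 0 (1 / |P.b 1|) : ℕ → ℝ) (k + (l + 1)) = 0 :=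
    fun l => by rw [Pi.single_eq_of_ne (by omega), mul_zero]
  rw [tsum_congr e, tsum_zero, add_zero, lowSum_single] at h
  refine (show |P.w k| ≤ _ from h).trans ?_
  have hb := abs_pos.2 (H.b_ne_zero 0)
  have h1 := H.one_sub_theta_sq_pos
  -- The first pivot is exactly `b_1`, so no factor `1/γ` arises; it is inserted only to reach `η`.
  have hle : 1 / (1 - P.theta ^ 2) ≤ P.eta := by
    unfold eta
    exact one_div_le_one_div_of_le (mul_pos (gamma_pos P) h1)
      (mul_le_of_le_one_left h1.le H.gamma_lt_one.le)
  calc P.theta ^ k * (1 / |P.b 1|) / (1 - P.theta ^ 2)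
      = 1 / (1 - P.theta ^ 2) * (P.theta ^ k / |P.b 1|) := by ring
    _ ≤ P.eta * (P.theta ^ k / |P.b 1|) :=
        mul_le_mul_of_nonneg_right hle (div_nonneg (pow_nonneg H.theta_pos.le k) (abs_nonneg _))
    _ = _ := by ring

theorem LIinv_single (n : ℕ) :
    P.LIinv (Pi.single 0 1) n
      = (-1) ^ n * (∏ i ∈ Finset.Icc 2 (n + 1), P.a i) * (P.dlt 0 / P.dlt n) := by
  induction n with
  | zero => simp [LIinv_zero, dlt]
  | succ n ih =>
    have h0 := H.dlt_ne_zero n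
    have h1 := H.dlt_ne_zero (n + 1)
    rw [H.LIinv_succ, ih, Pi.single_eq_of_ne n.succ_ne_zero, Finset.prod_Icc_succ_top (by omega : 2 ≤ n + 1 + 1), pow_succ, piv]
    field_simp
    ring

/-- Term `l` of the series of `w_0` carries one factor `θ^l` from each triangular factor. Since `w̃`
is a partial sum, the error is the remainder of a geometric series of ratio `θ²`. -/
theorem abs_w_zero_sub_wtilde_le :
    |P.w 0 - P.wtilde| ≤ P.theta ^ (2 * P.L) / (|P.b 1| * (1 - P.theta ^ 2)) := by
  set t : ℕ → ℝ := fun l => P.upCoef 0 l * (P.LIinv (Pi.single 0 1) (0 + l) / P.piv (0 + l)) with ht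
  have hbd : ∀ n, |(Pi.single 0 1 : ℕ → ℝ) n / P.piv n| ≤ 1 / |P.b 1| := fun n =>
    (abs_single_div_piv_le n).trans (single_le n)
  have hw : P.w 0 = ∑' l, t l := H.tailInv_eq_tsum hbd 0
  have hsum : Summable t :=
    H.summable_upCoef_mul (fun n => H.abs_LIinv_div_piv_le_of_le hbd (0 + n)) 0
  have htl : ∀ l, |t l| ≤ (P.theta ^ 2) ^ l * (1 / |P.b 1|) := by
    intro l
    have h := H.abs_LIinv_div_piv_le abs_single_div_piv_le l
    rw [lowSum_single] at h
    rw [ht]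
    simp only [zero_add]
    rw [abs_mul, ← pow_mul, two_mul, pow_add, mul_assoc]
    exact mul_le_mul (H.abs_upCoef_le 0 l) h (abs_nonneg _) (pow_nonneg H.theta_pos.le _)
  have hteq : ∀ l, t l = P.dlt 0 ^ 2 / (P.dlt l * P.dlt (l + 1))
      * (∏ i ∈ Finset.Icc 1 l, P.c i) * ∏ i ∈ Finset.Icc 2 (l + 1), P.a i := by
    intro l
    have h0 := H.dlt_ne_zero l
    have h1 := H.dlt_ne_zero (l + 1)
    have hsq : ((-1 : ℝ) ^ l) * (-1) ^ l = 1 := by rw [← mul_pow]; simp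
    simp only [ht, zero_add, H.LIinv_single, upCoef, piv]
    field_simp
    linear_combination (P.dlt 0 ^ 2 * (∏ i ∈ Finset.Icc 1 l, P.c i)
      * ∏ i ∈ Finset.Icc 2 (l + 1), P.a i) * hsq
  -- The term `l = 0` is always present in `w̃`, so `L = 0` gives the same sum as `L = 1`.
  have hwt : P.wtilde = ∑ l ∈ Finset.range (max P.L 1), t l := by
    have h0 : t 0 = P.dlt 0 / P.dlt 1 := by
      rw [hteq]
      simp [dlt]
    rw [Finset.range_eq_Ico, Finset.sum_eq_sum_Ico_succ_bot (by omega), h0]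
    unfold wtilde
    congr 1
    refine (Finset.sum_congr rfl fun l _ => (hteq l).symm).trans
      (Finset.sum_congr ?_ fun _ _ => rfl)
    ext l
    simp only [Finset.mem_Ico]
    omega
  have hth : P.theta ^ 2 < 1 := by linarith [H.one_sub_theta_sq_pos]
  have hgeo := (hasSum_geometric_of_lt_one (sq_nonneg P.theta) hth).mul_right
    ((P.theta ^ 2) ^ max P.L 1 * (1 / |P.b 1|))
  rw [hw, hwt, ← hsum.sum_add_tsum_nat_add (max P.L 1), add_sub_cancel_left,
    ← Real.norm_eq_abs]
  refine (tsum_of_norm_bounded hgeo fun l => ?_).trans ?_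
  · refine (htl _).trans_eq ?_
    rw [pow_add]
    ring
  · have hpow : (P.theta ^ 2) ^ max P.L 1 ≤ P.theta ^ (2 * P.L) := by
      rw [← pow_mul]
      exact pow_le_pow_of_le_one H.theta_pos.le H.theta_lt_one.le
        (Nat.mul_le_mul_left 2 (le_max_left _ _))
    have hb := abs_pos.2 (H.b_ne_zero 0)
    calc (1 - P.theta ^ 2)⁻¹ * ((P.theta ^ 2) ^ max P.L 1 * (1 / |P.b 1|))
        = (P.theta ^ 2) ^ max P.L 1 / (|P.b 1| * (1 - P.theta ^ 2)) := by
          have := H.one_sub_theta_sq_pos.ne'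
          field_simp
      _ ≤ _ := div_le_div_of_nonneg_right hpow (mul_nonneg hb.le H.one_sub_theta_sq_pos.le)

end TailDominant

end Data

/-! ### Monotonicity of the functions in `χ`, and geometric sums with weights -/

/-- The tangent inequality `1 + t ≤ e^t` at `t = (b-a)/a`. It replaces differentiation: a product of
powers and exponentials is compared with its value at `M` through its logarithmic derivative at `M`
alone. -/
theorem rpow_le_rpow_mul_exp {a b p : ℝ} (ha : 0 < a) (hb : 0 < b) (hp : 0 ≤ p) :
    b ^ p ≤ a ^ p * Real.exp (p * ((b - a) / a)) := by
  have h1 : b / a ≤ Real.exp ((b - a) / a) := by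
    have h := Real.add_one_le_exp ((b - a) / a)
    have e : (b - a) / a + 1 = b / a := by
      field_simp
      ring
    rwa [e] at h
  have h2 : b ≤ a * Real.exp ((b - a) / a) := by
    rw [div_le_iff₀ ha] at h1
    linarith
  calc b ^ p ≤ (a * Real.exp ((b - a) / a)) ^ p := Real.rpow_le_rpow hb.le h2 hp
    _ = a ^ p * Real.exp (p * ((b - a) / a)) := by
      rw [Real.mul_rpow ha.le (Real.exp_pos _).le, ← Real.exp_mul, mul_comm p]

theorem rpow_eq_rpow_mul_exp {θ : ℝ} (hθ : 0 < θ) (u v : ℝ) :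
    θ ^ v = θ ^ u * Real.exp (Real.log θ * (v - u)) := by
  rw [Real.rpow_def_of_pos hθ, Real.rpow_def_of_pos hθ, ← Real.exp_add]
  congr 1
  ring

/-- `θ^x (m + x)^p` is decreasing for `m + x ≥ -p / ln θ`. -/
theorem pow_mul_rpow_le {θ s m : ℝ} (hθ : 0 < θ) (hs : 0 ≤ s) (hm : 0 < m) {M k : ℕ} (hMk : M ≤ k)
    (h : Real.log θ + s / (m + M) ≤ 0) : θ ^ k * (m + k) ^ s ≤ θ ^ M * (m + M) ^ s := by
  have hM0 : (0 : ℝ) ≤ M := Nat.cast_nonneg M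
  have hMk' : (M : ℝ) ≤ k := by exact_mod_cast hMk
  have hmM : 0 < m + M := by linarith
  have h1 := rpow_le_rpow_mul_exp hmM (by linarith : 0 < m + (k : ℝ)) hs
  have h2 := rpow_eq_rpow_mul_exp hθ M k
  rw [Real.rpow_natCast, Real.rpow_natCast] at h2
  rw [h2]
  calc θ ^ M * Real.exp (Real.log θ * (k - M)) * (m + k) ^ s
      ≤ θ ^ M * Real.exp (Real.log θ * (k - M))
        * ((m + M) ^ s * Real.exp (s * ((m + k - (m + M)) / (m + M)))) := by gcongr
    _ = θ ^ M * (m + M) ^ s * Real.exp ((k - M) * (Real.log θ + s / (m + M))) := by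
      rw [show (k - M) * (Real.log θ + s / (m + M))
        = Real.log θ * (k - M) + s * ((m + k - (m + M)) / (m + M)) by ring, Real.exp_add]
      ring
    _ ≤ θ ^ M * (m + M) ^ s * 1 := by
      gcongr
      rw [Real.exp_le_one_iff]
      exact mul_nonpos_of_nonneg_of_nonpos (by linarith) h
    _ = _ := mul_one _

/-- A quadratic with negative leading and positive constant coefficient is nonpositive beyond its
larger root. -/
theorem quadratic_nonpos_of_root_le {t B c x : ℝ} (ht : t < 0)
    (h : (-B - Real.sqrt (B ^ 2 - 4 * t * c)) / (2 * t) ≤ x) (hc : 0 ≤ c) :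
    t * x ^ 2 + B * x + c ≤ 0 := by
  rw [div_le_iff_of_neg (by linarith)] at h
  have hd : 0 ≤ B ^ 2 - 4 * t * c := by nlinarith [sq_nonneg B]
  have h1 : Real.sqrt (B ^ 2 - 4 * t * c) ≤ -(2 * t * x + B) := by linarith
  have h2 : B ^ 2 - 4 * t * c ≤ (2 * t * x + B) ^ 2 := by
    rw [← Real.sq_sqrt hd, ← neg_sq (2 * t * x + B)]
    exact pow_le_pow_left₀ (Real.sqrt_nonneg _) h1 2
  nlinarith

/-- `θ^{x/2} x (m + x)^p` is decreasing beyond the critical point of its logarithm. -/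
theorem rpow_half_mul_le {θ p m : ℝ} (hθ : 0 < θ) (hp : 0 ≤ p) (hm : 0 < m) {M k : ℕ}
    (hM : 0 < M) (hMk : M ≤ k)
    (h : Real.log θ / 2 + 1 / M + p / (m + M) ≤ 0) :
    θ ^ ((k : ℝ) / 2) * ((k : ℝ) / 2) * ((m + k) / m) ^ p
      ≤ θ ^ ((M : ℝ) / 2) * ((M : ℝ) / 2) * ((m + M) / m) ^ p := by
  have hM0 : (0 : ℝ) < M := by exact_mod_cast hM
  have hMk' : (M : ℝ) ≤ k := by exact_mod_cast hMk
  have hmM : 0 < m + M := by linarith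
  have h1 := rpow_le_rpow_mul_exp hmM (by linarith : 0 < m + (k : ℝ)) hp
  have h2 := rpow_eq_rpow_mul_exp hθ ((M : ℝ) / 2) ((k : ℝ) / 2)
  have h3 := rpow_le_rpow_mul_exp hM0 (by linarith : 0 < (k : ℝ)) zero_le_one
  rw [Real.rpow_one, Real.rpow_one, one_mul] at h3
  rw [Real.div_rpow (by linarith) hm.le, Real.div_rpow hmM.le hm.le, h2]
  calc θ ^ ((M : ℝ) / 2) * Real.exp (Real.log θ * ((k : ℝ) / 2 - M / 2)) * ((k : ℝ) / 2)
        * ((m + k) ^ p / m ^ p)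
      ≤ θ ^ ((M : ℝ) / 2) * Real.exp (Real.log θ * ((k : ℝ) / 2 - M / 2))
        * ((M * Real.exp ((k - M) / M)) / 2)
        * (((m + M) ^ p * Real.exp (p * ((m + k - (m + M)) / (m + M)))) / m ^ p) := by gcongr
    _ = θ ^ ((M : ℝ) / 2) * ((M : ℝ) / 2) * ((m + M) ^ p / m ^ p)
        * Real.exp ((k - M) * (Real.log θ / 2 + 1 / M + p / (m + M))) := by
      rw [show (k - M) * (Real.log θ / 2 + 1 / M + p / (m + M))
        = Real.log θ * ((k : ℝ) / 2 - M / 2) + (k - M) / M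
          + p * ((m + k - (m + M)) / (m + M)) by ring, Real.exp_add, Real.exp_add]
      ring
    _ ≤ θ ^ ((M : ℝ) / 2) * ((M : ℝ) / 2) * ((m + M) ^ p / m ^ p) * 1 := by
      gcongr
      rw [Real.exp_le_one_iff]
      exact mul_nonpos_of_nonneg_of_nonpos (by linarith) h
    _ = _ := mul_one _

/-- `θ^{√x} x` is decreasing for `x ≥ 4 / (ln θ)²`. -/
theorem rpow_sqrt_mul_le {θ : ℝ} (hθ : 0 < θ) (hθ1 : θ < 1) {M k : ℕ} (hM : 0 < M) (hMk : M ≤ k)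
    (h : 4 / Real.log θ ^ 2 ≤ M) :
    θ ^ Real.sqrt k * ((k : ℝ) / 2) ≤ θ ^ Real.sqrt M * ((M : ℝ) / 2) := by
  have hM0 : (0 : ℝ) < M := by exact_mod_cast hM
  have hMk' : (M : ℝ) ≤ k := by exact_mod_cast hMk
  have hl : Real.log θ < 0 := Real.log_neg hθ hθ1
  set u := Real.sqrt M with hu
  set v := Real.sqrt k with hv
  have hu0 : 0 < u := Real.sqrt_pos.2 hM0
  have huv : u ≤ v := Real.sqrt_le_sqrt hMk'
  have hu2 : u ^ 2 = M := Real.sq_sqrt hM0.le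
  have hv2 : v ^ 2 = k := Real.sq_sqrt (by linarith)
  -- The left side is the logarithmic derivative of `θ^u u²` in `u = √x`; the hypothesis `4 / (ln
  -- θ)² ≤ M` makes it nonpositive.
  have hcrit : Real.log θ + 2 / u ≤ 0 := by
    rw [div_le_iff₀ (sq_pos_of_neg hl), ← hu2] at h
    have h2 : 2 ≤ -Real.log θ * u := by
      by_contra hc
      have h0 : 0 < -Real.log θ * u := mul_pos (by linarith) hu0
      nlinarith
    have h3 : 2 / u ≤ -Real.log θ := by
      rw [div_le_iff₀ hu0]
      exact h2
    linarith
  have h1 := rpow_le_rpow_mul_exp hu0 (hu0.trans_le huv) (zero_le_two)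
  rw [Real.rpow_two, Real.rpow_two, hu2, hv2] at h1
  rw [rpow_eq_rpow_mul_exp hθ u v]
  calc θ ^ u * Real.exp (Real.log θ * (v - u)) * ((k : ℝ) / 2)
      ≤ θ ^ u * Real.exp (Real.log θ * (v - u)) * ((M * Real.exp (2 * ((v - u) / u))) / 2) := by
        gcongr
    _ = θ ^ u * ((M : ℝ) / 2) * Real.exp ((v - u) * (Real.log θ + 2 / u)) := by
      rw [show (v - u) * (Real.log θ + 2 / u) = Real.log θ * (v - u) + 2 * ((v - u) / u) by ring,
        Real.exp_add]
      ring
    _ ≤ θ ^ u * ((M : ℝ) / 2) * 1 := by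
      gcongr
      rw [Real.exp_le_one_iff]
      exact mul_nonpos_of_nonneg_of_nonpos (by linarith) hcrit
    _ = _ := mul_one _

theorem add_sub_sqrt_sub_one_pos {m : ℝ} (hm : 6 ≤ m) (k : ℕ) :
    0 < m + k - Real.sqrt k - 1 := by
  have h := Real.sq_sqrt (Nat.cast_nonneg k : (0 : ℝ) ≤ k)
  nlinarith [sq_nonneg (Real.sqrt k - 1)]

theorem div_sub_sqrt_le {m : ℝ} (hm : 6 ≤ m) {M k : ℕ} (hmM : m ≤ M) (hMk : M ≤ k) :
    (m + k) / (m + k - Real.sqrt k - 1) ≤ (m + M) / (m + M - Real.sqrt M - 1) := by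
  have hM0 : (0 : ℝ) ≤ M := Nat.cast_nonneg M
  have hMk' : (M : ℝ) ≤ k := by exact_mod_cast hMk
  rw [div_le_div_iff₀ (add_sub_sqrt_sub_one_pos hm k) (add_sub_sqrt_sub_one_pos hm M)]
  have hu0 : 0 ≤ Real.sqrt M := Real.sqrt_nonneg _
  have huv : Real.sqrt M ≤ Real.sqrt k := Real.sqrt_le_sqrt hMk'
  have hu2 := Real.sq_sqrt hM0
  have hv2 := Real.sq_sqrt (hM0.trans hMk')
  set u := Real.sqrt M
  set v := Real.sqrt k
  -- This product is the difference of the cross-multiplied sides once `M = u²` and `k = v²`; its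
  -- second factor is nonnegative because `u * v ≥ u² = M ≥ m`.
  have h1 : 0 ≤ (v - u) * (u * v + v + u - m) :=
    mul_nonneg (by linarith) (by nlinarith)
  rw [← hu2, ← hv2]
  linarith

/-- The three ranges `k - l ≤ √k + 1`, `√k < k - l ≤ (k + 1) / 2` and `k - l > k / 2` of the sum
`∑_{l ≤ k} θ^{k-l} ((m + k) / (m + l))^p` are estimated separately. -/
theorem sum_pow_mul_rpow_le {θ p m : ℝ} (hθ : 0 < θ) (hθ1 : θ < 1) (hp : 0 ≤ p) (hm : 6 ≤ m)
    (k : ℕ) :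
    ∑ l ∈ Finset.range (k + 1), θ ^ (k - l) * ((m + k) / (m + l)) ^ p
      ≤ θ ^ ((k : ℝ) / 2) * ((k : ℝ) / 2) * ((m + k) / m) ^ p
        + θ ^ Real.sqrt k * ((k : ℝ) / 2) * (2 : ℝ) ^ p
        + 1 / (1 - θ) * ((m + k) / (m + k - Real.sqrt k - 1)) ^ p := by
  have hk0 : (0 : ℝ) ≤ k := Nat.cast_nonneg k
  have hpos := add_sub_sqrt_sub_one_pos hm k
  set R : ℝ := ((m + k) / (m + k - Real.sqrt k - 1)) ^ p with hR
  have hR0 : 0 ≤ R := Real.rpow_nonneg (div_nonneg (by linarith) hpos.le) p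
  set h : ℕ := (k + 1) / 2
  have hq1 : (Nat.sqrt k : ℝ) ≤ Real.sqrt k := Real.nat_sqrt_le_real_sqrt
  have hq2 : Real.sqrt k < Nat.sqrt k + 1 := Real.real_sqrt_lt_nat_sqrt_succ
  have hrefl : ∑ l ∈ Finset.range (k + 1), θ ^ (k - l) * ((m + k) / (m + l)) ^ p
      = ∑ i ∈ Finset.range (k + 1), θ ^ i * ((m + k) / (m + k - i)) ^ p := by
    rw [← Finset.sum_range_reflect]
    refine Finset.sum_congr rfl fun i hi => ?_
    rw [Finset.mem_range] at hi
    rw [show k - (k + 1 - 1 - i) = i by omega, show k + 1 - 1 - i = k - i by omega,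
      Nat.cast_sub (by omega), add_sub_assoc]
  -- Here `i = k - l`. The geometric summand is kept for every `i`, and the other two are switched
  -- on in their ranges. The cut at `Nat.sqrt k + 1` yields the denominator with `√k + 1`, and the
  -- cut at `h`, half of `k` rounded up, leaves at most `k/2` indices in each of the other ranges.
  have hterm : ∀ i ∈ Finset.range (k + 1), θ ^ i * ((m + k) / (m + k - i)) ^ p
      ≤ θ ^ i * R
        + (if i ∈ Finset.Icc (Nat.sqrt k + 2) h then θ ^ Real.sqrt k * (2 : ℝ) ^ p else 0)
        + (if i ∈ Finset.Icc (h + 1) k then θ ^ ((k : ℝ) / 2) * ((m + k) / m) ^ p else 0) := by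
    intro i hi
    have hik : i ≤ k := Nat.lt_succ_iff.1 (Finset.mem_range.1 hi)
    have hik' : (i : ℝ) ≤ k := by exact_mod_cast hik
    have hg1 : 0 ≤ θ ^ i * R := mul_nonneg (pow_nonneg hθ.le i) hR0
    have hg2 : (0 : ℝ) ≤
        if i ∈ Finset.Icc (Nat.sqrt k + 2) h then θ ^ Real.sqrt k * (2 : ℝ) ^ p else 0 := by
      split_ifs <;> positivity
    have hg3 : (0 : ℝ) ≤
        if i ∈ Finset.Icc (h + 1) k then θ ^ ((k : ℝ) / 2) * ((m + k) / m) ^ p else 0 := by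
      split_ifs
      · have : 0 ≤ (m + k) / m := div_nonneg (by linarith) (by linarith)
        positivity
      · exact le_rfl
    have hdiv : 0 ≤ (m + k) / (m + k - i) := div_nonneg (by linarith) (by linarith)
    rcases Nat.lt_or_ge i (Nat.sqrt k + 2) with h1 | h1
    · have h1' : (i : ℝ) ≤ Nat.sqrt k + 1 := by exact_mod_cast Nat.lt_succ_iff.1 h1
      have : θ ^ i * ((m + k) / (m + k - i)) ^ p ≤ θ ^ i * R := by
        refine mul_le_mul_of_nonneg_left (Real.rpow_le_rpow hdiv ?_ hp) (pow_nonneg hθ.le i)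
        exact div_le_div_of_nonneg_left (by linarith) hpos (by linarith)
      linarith
    · rcases Nat.lt_or_ge h i with h2 | h2
      · rw [if_pos (Finset.mem_Icc.2 ⟨h2, hik⟩)] at hg3 ⊢
        have h3 : (k : ℝ) / 2 ≤ i := by
          have : k ≤ i * 2 := by omega
          rw [div_le_iff₀ two_pos]
          exact_mod_cast this
        have : θ ^ i * ((m + k) / (m + k - i)) ^ p
            ≤ θ ^ ((k : ℝ) / 2) * ((m + k) / m) ^ p := by
          refine mul_le_mul ?_ (Real.rpow_le_rpow hdiv ?_ hp) (Real.rpow_nonneg hdiv p)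
            (Real.rpow_nonneg hθ.le _)
          · rw [← Real.rpow_natCast]
            exact Real.rpow_le_rpow_of_exponent_ge hθ hθ1.le h3
          · exact div_le_div_of_nonneg_left (by linarith) (by linarith) (by linarith)
        linarith
      · rw [if_pos (Finset.mem_Icc.2 ⟨h1, h2⟩)] at hg2 ⊢
        have h3 : Real.sqrt k ≤ i := by
          have : ((Nat.sqrt k + 2 : ℕ) : ℝ) ≤ i := by exact_mod_cast h1
          push_cast at this
          linarith
        have h4 : (i : ℝ) * 2 ≤ k + 1 := by
          have : i * 2 ≤ k + 1 := by omega
          exact_mod_cast this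
        have : θ ^ i * ((m + k) / (m + k - i)) ^ p ≤ θ ^ Real.sqrt k * (2 : ℝ) ^ p := by
          refine mul_le_mul ?_ (Real.rpow_le_rpow hdiv ?_ hp) (Real.rpow_nonneg hdiv p)
            (Real.rpow_nonneg hθ.le _)
          · rw [← Real.rpow_natCast]
            exact Real.rpow_le_rpow_of_exponent_ge hθ hθ1.le h3
          · rw [div_le_iff₀ (by linarith)]
            linarith
        linarith
  have hcard : ∀ (a b : ℕ) (c : ℝ), 0 ≤ c → ((b + 1 - a : ℕ) : ℝ) ≤ (k : ℝ) / 2 →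
      ∑ i ∈ Finset.range (k + 1), (if i ∈ Finset.Icc a b then c else 0) ≤ (k : ℝ) / 2 * c := by
    intro a b c hc hab
    rw [Finset.sum_ite_mem, Finset.sum_const, nsmul_eq_mul]
    refine mul_le_mul_of_nonneg_right (le_trans ?_ hab) hc
    have := Finset.card_le_card (Finset.inter_subset_right (s₁ := Finset.range (k + 1))
      (s₂ := Finset.Icc a b))
    rw [Nat.card_Icc] at this
    exact_mod_cast this
  have hgeo : ∑ i ∈ Finset.range (k + 1), θ ^ i ≤ 1 / (1 - θ) := by
    rw [one_div, ← tsum_geometric_of_lt_one hθ.le hθ1]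
    exact (summable_geometric_of_lt_one hθ.le hθ1).sum_le_tsum _ fun i _ => pow_nonneg hθ.le i
  have hc2 := hcard (Nat.sqrt k + 2) h (θ ^ Real.sqrt k * (2 : ℝ) ^ p) (by positivity) (by
    rw [le_div_iff₀ two_pos]
    have : (h + 1 - (Nat.sqrt k + 2)) * 2 ≤ k := by omega
    exact_mod_cast this)
  have hc3 := hcard (h + 1) k (θ ^ ((k : ℝ) / 2) * ((m + k) / m) ^ p) (by
      have : 0 ≤ (m + k) / m := div_nonneg (by linarith) (by linarith)
      positivity) (by
    rw [le_div_iff₀ two_pos]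
    have : (k + 1 - (h + 1)) * 2 ≤ k := by omega
    exact_mod_cast this)
  rw [hrefl]
  refine (Finset.sum_le_sum hterm).trans ?_
  rw [Finset.sum_add_distrib, Finset.sum_add_distrib, ← Finset.sum_mul]
  have hgR := mul_le_mul_of_nonneg_right hgeo hR0
  linarith

/-- The sums `∑_{l ≤ k} θ^{k-l} ((m + k) / (m + l))^p` are bounded in `k`. -/
theorem exists_sum_pow_mul_rpow_le {θ m : ℝ} (hθ : 0 < θ) (hθ1 : θ < 1) (p : ℝ) (hp : 0 ≤ p)
    (hm : 1 ≤ m) :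
    ∃ C, ∀ k : ℕ, ∑ l ∈ Finset.range (k + 1), θ ^ (k - l) * ((m + k) / (m + l)) ^ p ≤ C := by
  obtain ⟨d, hd⟩ := exists_nat_ge p
  have hs : Summable fun i : ℕ => ((i : ℝ) + 1) ^ d * θ ^ i := by
    have hnorm : ‖θ‖ < 1 := by rwa [Real.norm_of_nonneg hθ.le]
    have h := (summable_nat_add_iff 1).2
      (summable_pow_mul_geometric_of_norm_lt_one (R := ℝ) d hnorm)
    refine (h.mul_right θ⁻¹).congr fun i => ?_
    push_cast
    rw [pow_succ]
    field_simp
  refine ⟨∑' i : ℕ, ((i : ℝ) + 1) ^ d * θ ^ i, fun k => ?_⟩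
  rw [← Finset.sum_range_reflect]
  refine le_trans (Finset.sum_le_sum fun i hi => ?_)
    (hs.sum_le_tsum (Finset.range (k + 1)) fun i _ => by positivity)
  rw [Finset.mem_range] at hi
  have hik : (i : ℝ) ≤ k := by exact_mod_cast Nat.lt_succ_iff.1 hi
  have hi0 : (0 : ℝ) ≤ i := Nat.cast_nonneg i
  rw [show k - (k + 1 - 1 - i) = i by omega, show k + 1 - 1 - i = k - i by omega,
    Nat.cast_sub (by omega), mul_comm]
  have hq : 0 ≤ (m + k) / (m + (k - i)) := div_nonneg (by linarith) (by linarith)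
  refine mul_le_mul_of_nonneg_right ?_ (pow_nonneg hθ.le i)
  -- As `m ≥ 1` and `i ≤ k`, the quotient is at most `i + 1`, which is free of `k`; polynomial times
  -- geometric is summable.
  calc ((m + k) / (m + (k - i))) ^ p ≤ ((i : ℝ) + 1) ^ p := by
        refine Real.rpow_le_rpow hq ?_ hp
        rw [div_le_iff₀ (by linarith)]
        nlinarith
    _ ≤ ((i : ℝ) + 1) ^ (d : ℝ) := Real.rpow_le_rpow_of_exponent_le (by linarith) hd
    _ = _ := Real.rpow_natCast _ _

/-! ### Consequences of the conditions `(M_A)` and `(M_Y)` -/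

namespace Data

variable {P : Data}

/-- Beyond `M` the constant `χ` bounds the sums `∑_{l ≤ k} θ^{k-l} ((m + k) / (m + l))^{s + s_L}`. -/
theorem TailDominant.sum_le_chi (H : P.TailDominant) (hs : 2 ≤ P.s) (hsL : 0 < P.sL) (hm : 6 ≤ P.m)
    {M k : ℕ} (hMA : P.CondMA M) (hk : M ≤ k) :
    ∑ l ∈ Finset.range (k + 1),
      P.theta ^ (k - l) * (((P.m : ℝ) + k) / ((P.m : ℝ) + l)) ^ (P.s + P.sL) ≤ P.chi M := by
  have hm' : (6 : ℝ) ≤ P.m := by exact_mod_cast hm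
  obtain ⟨h12, h3⟩ := max_le_iff.1 hMA
  obtain ⟨h1, h2⟩ := max_le_iff.1 h12
  have hM0 : 0 < M := by
    have : P.m ≤ M := by exact_mod_cast h3
    omega
  have hM0' : (0 : ℝ) < M := by exact_mod_cast hM0
  have hp : 0 ≤ P.s + P.sL := by linarith
  have ht : Real.log P.theta < 0 := Real.log_neg H.theta_pos H.theta_lt_one
  have hlog : Real.log (Real.sqrt P.theta) = Real.log P.theta / 2 := Real.log_sqrt H.theta_pos.le
  -- Multiplied by `M (m + M)` this is a quadratic in `M` with leading coefficient `ln √θ`, and the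
  -- first entry of `(M_A)` is its larger root.
  have hcrit : Real.log P.theta / 2 + 1 / M + (P.s + P.sL) / (P.m + M) ≤ 0 := by
    rw [hlog] at h1
    have hq := quadratic_nonpos_of_root_le (t := Real.log P.theta / 2)
      (B := P.m * (Real.log P.theta / 2) + P.s + P.sL + 1) (c := P.m) (x := M) (by linarith) (by
        rw [show -(P.m * (Real.log P.theta / 2) + P.s + P.sL + 1)
            = -P.m * (Real.log P.theta / 2) - P.s - P.sL - 1 by ring,
          show 4 * (Real.log P.theta / 2) * P.m = 4 * P.m * (Real.log P.theta / 2) by ring]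
        exact h1) (by linarith)
    have e : Real.log P.theta / 2 + 1 / M + (P.s + P.sL) / (P.m + M)
        = (Real.log P.theta / 2 * (M : ℝ) ^ 2
          + (P.m * (Real.log P.theta / 2) + P.s + P.sL + 1) * M + P.m) / (M * (P.m + M)) := by
      have : (P.m : ℝ) + M ≠ 0 := by positivity
      field_simp
      ring
    rw [e]
    exact div_nonpos_of_nonpos_of_nonneg hq (by positivity)
  refine (sum_pow_mul_rpow_le H.theta_pos H.theta_lt_one hp hm' k).trans ?_
  unfold chi
  have e1 := rpow_half_mul_le H.theta_pos hp (by linarith : (0 : ℝ) < P.m) hM0 hk hcrit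
  have e2 := mul_le_mul_of_nonneg_right
    (rpow_sqrt_mul_le H.theta_pos H.theta_lt_one hM0 hk h2)
    (Real.rpow_nonneg zero_le_two (P.s + P.sL))
  have e3 : 1 / (1 - P.theta) * (((P.m : ℝ) + k) / (P.m + k - Real.sqrt k - 1)) ^ (P.s + P.sL)
      ≤ 1 / (1 - P.theta) * (((P.m : ℝ) + M) / (P.m + M - Real.sqrt M - 1)) ^ (P.s + P.sL) := by
    have := H.theta_lt_one
    refine mul_le_mul_of_nonneg_left (Real.rpow_le_rpow ?_ (div_sub_sqrt_le hm' h3 hk) hp)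
      (one_div_nonneg.2 (by linarith))
    exact div_nonneg (by positivity) (add_sub_sqrt_sub_one_pos hm' k).le
  linarith

/-- Condition `(M_Y)` puts `M` beyond the maximum of `θ^x (m + x)^s`. This lets geometric bounds be
continued past `m + M` by the ratio of weights. -/
theorem TailDominant.theta_pow_le (H : P.TailDominant) (hs : 2 ≤ P.s) {M k : ℕ}
    (hMY : P.CondMY M) (hk : M ≤ k) :
    P.theta ^ k ≤ P.theta ^ M * (wt P.s (P.m + M) / wt P.s (P.m + k)) := by
  have hm0 : (0 : ℝ) < P.m := by exact_mod_cast P.m_pos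
  have ht : Real.log P.theta < 0 := Real.log_neg H.theta_pos H.theta_lt_one
  have h1 := (max_le_iff.1 hMY).1
  have hmM : (0 : ℝ) < (P.m : ℝ) + M := by positivity
  have hcrit : Real.log P.theta + P.s / (P.m + M) ≤ 0 := by
    have h2 : -P.s / Real.log P.theta ≤ P.m + M := by linarith
    rw [div_le_iff_of_neg ht] at h2
    have h3 : P.s / (P.m + M) ≤ -Real.log P.theta := by
      rw [div_le_iff₀ hmM]
      linarith
    linarith
  have h := pow_mul_rpow_le H.theta_pos (by linarith : 0 ≤ P.s) hm0 hk hcrit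
  have e : ∀ j : ℕ, wt P.s (P.m + j) = ((P.m : ℝ) + j) ^ P.s := fun j => by
    rw [wt_of_pos (by have := P.m_pos; omega)]
    push_cast
    rfl
  rw [← mul_div_assoc, le_div_iff₀ (wt_pos _ _), e, e]
  exact h

theorem b_one : P.b 1 = P.mu P.m := rfl

theorem c_one : P.c 1 = P.beta P.m := rfl

theorem wt_m_add (p : ℝ) (n : ℕ) : wt p (P.m + n) = ((P.m : ℝ) + n) ^ p := by
  rw [wt_of_pos (by have := P.m_pos; omega)]
  push_cast
  rfl

/-! ### Decay of the tail inverse -/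

/-- The pivots are at least `γ C₁ ω^{s_L}`, so dividing by them gains `s_L` orders of decay. -/
theorem Assumptions.abs_div_piv_le {C2 : ℝ} {k0 : ℕ} (hA : P.Assumptions C2 k0) (hk0 : k0 ≤ P.m)
    {t κ : ℝ} {y : ℕ → ℝ} (hy : ∀ n, |y n| ≤ κ / wt t (P.m + n)) (n : ℕ) :
    |y n / P.piv n| ≤ κ / (P.gamma * P.C1) / wt (t + P.sL) (P.m + n) := by
  have H := hA.tailDominant hk0
  have hmu : P.C1 * wt P.sL (P.m + n) ≤ |P.b (n + 1)| := hA.mu_pos (by omega)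
  have hg := TailDominant.gamma_pos P
  have h1 : P.gamma * (P.C1 * wt P.sL (P.m + n)) ≤ |P.piv n| :=
    (mul_le_mul_of_nonneg_left hmu hg.le).trans (H.le_abs_piv n)
  rw [abs_div]
  refine (div_le_div₀ ((abs_nonneg _).trans (hy n)) (hy n)
    (mul_pos hg (mul_pos hA.C1_pos (wt_pos _ _))) h1).trans_eq ?_
  rw [wt_add, div_div, div_div]
  congr 1
  ring

theorem Assumptions.exists_abs_div_piv_le {C2 : ℝ} {k0 : ℕ} (hA : P.Assumptions C2 k0)
    (hk0 : k0 ≤ P.m) {t κ : ℝ} (ht : 0 ≤ t + P.sL) {y : ℕ → ℝ}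
    (hy : ∀ n, |y n| ≤ κ / wt t (P.m + n)) : ∃ B, ∀ n, |y n / P.piv n| ≤ B := by
  refine ⟨κ / (P.gamma * P.C1), fun n => (hA.abs_div_piv_le hk0 hy n).trans ?_⟩
  have hκ : 0 ≤ κ := by
    have := (abs_nonneg _).trans (hy 0)
    rwa [le_div_iff₀ (wt_pos _ _), zero_mul] at this
  exact div_le_self (div_nonneg hκ (mul_pos (TailDominant.gamma_pos P) hA.C1_pos).le)
    (one_le_wt ht _)

/-- Below the diagonal the weight ratios must be kept in the sum; above it the weights only help,
and the geometric series gives `θ/(1-θ)`. The exponent `t` is free because `t = s - s_L` serves the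
boundedness of `A` and `t = s` the bounds `D^i`. -/
theorem Assumptions.abs_tailInv_le {C2 : ℝ} {k0 : ℕ} (hA : P.Assumptions C2 k0) (hk0 : k0 ≤ P.m)
    {t κ : ℝ} (ht : 0 ≤ t + P.sL) {y : ℕ → ℝ} (hy : ∀ n, |y n| ≤ κ / wt t (P.m + n)) (k : ℕ) :
    |P.tailInv y k| ≤ P.eta * κ / (P.C1 * wt (t + P.sL) (P.m + k))
      * (∑ l ∈ Finset.range (k + 1),
          P.theta ^ (k - l) * (((P.m : ℝ) + k) / ((P.m : ℝ) + l)) ^ (t + P.sL)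
        + P.theta / (1 - P.theta)) := by
  have H := hA.tailDominant hk0
  have hm0 : (0 : ℝ) < P.m := by exact_mod_cast P.m_pos
  have hg := TailDominant.gamma_pos P
  have hC1 := hA.C1_pos
  have hκ : 0 ≤ κ := by
    have := (abs_nonneg _).trans (hy 0)
    rwa [le_div_iff₀ (wt_pos _ _), zero_mul] at this
  set c : ℝ := κ / (P.gamma * P.C1) with hc
  have hc0 : 0 ≤ c := div_nonneg hκ (mul_pos hg hC1).le
  set V : ℕ → ℝ := fun n => wt (t + P.sL) (P.m + n) with hV
  have hV0 : ∀ n, 0 < V n := fun n => wt_pos _ _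
  have hYB : ∀ n, c / V n ≤ c := fun n => div_le_self hc0 (one_le_wt ht _)
  have h := H.abs_tailInv_le (Y := fun n => c / V n) (hA.abs_div_piv_le hk0 hy) hYB k
  have hlow : P.lowSum (fun n => c / V n) k
      = c / V k * ∑ l ∈ Finset.range (k + 1),
          P.theta ^ (k - l) * (((P.m : ℝ) + k) / ((P.m : ℝ) + l)) ^ (t + P.sL) := by
    unfold lowSum
    rw [Finset.mul_sum]
    refine Finset.sum_congr rfl fun l _ => ?_
    rw [Real.div_rpow (by positivity) (by positivity), ← wt_m_add, ← wt_m_add]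
    have := (hV0 k).ne'
    have := (hV0 l).ne'
    simp only [hV] at *
    field_simp
  have hgeo := (hasSum_geometric_of_lt_one H.theta_pos.le H.theta_lt_one).mul_right
    (P.theta * (c / V k))
  have hup : ∑' l, P.theta ^ (l + 1) * (c / V (k + (l + 1)))
      ≤ c / V k * (P.theta / (1 - P.theta)) := by
    have hle : ∀ l, P.theta ^ (l + 1) * (c / V (k + (l + 1)))
        ≤ P.theta ^ l * (P.theta * (c / V k)) := by
      intro l
      rw [pow_succ, mul_assoc]
      refine mul_le_mul_of_nonneg_left (mul_le_mul_of_nonneg_left ?_ H.theta_pos.le)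
        (pow_nonneg H.theta_pos.le l)
      exact div_le_div_of_nonneg_left hc0 (hV0 k) (wt_mono ht (by omega))
    have hsum : Summable fun l => P.theta ^ (l + 1) * (c / V (k + (l + 1))) :=
      Summable.of_nonneg_of_le (fun l => mul_nonneg (pow_nonneg H.theta_pos.le _)
        (div_nonneg hc0 (hV0 _).le)) hle hgeo.summable
    refine (hsum.tsum_le_tsum hle hgeo.summable).trans_eq ?_
    rw [hgeo.tsum_eq, div_eq_mul_inv P.theta]
    ring
  refine h.trans ?_
  rw [div_le_iff₀ H.one_sub_theta_sq_pos, hlow]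
  refine (add_le_add_right hup _).trans_eq ?_
  have h1 := H.one_sub_theta_sq_pos.ne'
  have h2 := (hV0 k).ne'
  have e : P.eta * κ / (P.C1 * V k) * (1 - P.theta ^ 2) = c / V k := by
    rw [hc]
    unfold eta
    field_simp
  rw [← mul_add, ← e]
  ring

/-! ### The operator `A` -/

variable (P) in
theorem A_fin (y : ℕ → ℝ) (i : Fin P.m) :
    P.A y i = (∑ j, P.Am i j * y j)
      - P.beta (P.m - 1) * (P.Am i P.last * P.tailInv (P.tail y) 0) := by
  simp [A]

variable (P) in
-- Back-substitution in the block elimination: the finite block enters the tail only through the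
-- entry `m - 1` of `A y`. Every tail bound thus reduces to one finite entry.
theorem A_tail (y : ℕ → ℝ) (n : ℕ) :
    P.A y (P.m + n)
      = -P.lam P.m * P.w n * P.A y P.last + P.tailInv (P.tail y) n := by
  rw [A_fin]
  simp only [A, not_lt.2 (Nat.le_add_right P.m n), dite_false, Nat.add_sub_cancel_left]
  ring

theorem eq_fin_or_eq_add (k : ℕ) : (∃ i : Fin P.m, k = i) ∨ ∃ n, k = P.m + n := by
  rcases lt_or_ge k P.m with h | h
  · exact Or.inl ⟨⟨k, h⟩, rfl⟩
  · exact Or.inr ⟨k - P.m, by omega⟩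

theorem tail_add (y z : ℕ → ℝ) : P.tail (y + z) = P.tail y + P.tail z := rfl

theorem tail_smul (r : ℝ) (y : ℕ → ℝ) : P.tail (r • y) = r • P.tail y := rfl

theorem Assumptions.exists_tail_div_piv_le {C2 : ℝ} {k0 : ℕ} (hA : P.Assumptions C2 k0)
    (hk0 : k0 ≤ P.m) (hs : 0 ≤ P.s) {y : ℕ → ℝ} (hy : MemOmega (P.s - P.sL) y) :
    ∃ B, ∀ n, |P.tail y n / P.piv n| ≤ B :=
  hA.exists_abs_div_piv_le hk0 (t := P.s - P.sL) (by linarith) fun n => hy.abs_le (P.m + n)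

theorem Assumptions.A_add {C2 : ℝ} {k0 : ℕ} (hA : P.Assumptions C2 k0) (hk0 : k0 ≤ P.m)
    (hs : 0 ≤ P.s) {y z : ℕ → ℝ} (hy : MemOmega (P.s - P.sL) y) (hz : MemOmega (P.s - P.sL) z) :
    P.A (y + z) = P.A y + P.A z := by
  obtain ⟨B, hB⟩ := hA.exists_tail_div_piv_le hk0 hs hy
  obtain ⟨C, hC⟩ := hA.exists_tail_div_piv_le hk0 hs hz
  have hQ := (hA.tailDominant hk0).tailInv_add hB hC
  have hfin : ∀ i : Fin P.m, P.A (y + z) i = P.A y i + P.A z i := by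
    intro i
    simp only [A_fin, tail_add, hQ, Pi.add_apply, mul_add, Finset.sum_add_distrib]
    ring
  funext k
  rcases P.eq_fin_or_eq_add k with ⟨i, rfl⟩ | ⟨n, rfl⟩
  · exact hfin i
  · rw [Pi.add_apply, A_tail, A_tail, A_tail, hfin, tail_add, hQ, Pi.add_apply]
    ring

theorem Assumptions.A_smul {C2 : ℝ} {k0 : ℕ} (hA : P.Assumptions C2 k0) (hk0 : k0 ≤ P.m)
    (hs : 0 ≤ P.s) (r : ℝ) {y : ℕ → ℝ} (hy : MemOmega (P.s - P.sL) y) :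
    P.A (r • y) = r • P.A y := by
  obtain ⟨B, hB⟩ := hA.exists_tail_div_piv_le hk0 hs hy
  have hQ := (hA.tailDominant hk0).tailInv_smul r hB
  have hfin : ∀ i : Fin P.m, P.A (r • y) i = r * P.A y i := by
    intro i
    simp only [A_fin, tail_smul, hQ, Pi.smul_apply, smul_eq_mul, mul_sub, Finset.mul_sum]
    congr 1
    · exact Finset.sum_congr rfl fun j _ => by ring
    · ring
  funext k
  rcases P.eq_fin_or_eq_add k with ⟨i, rfl⟩ | ⟨n, rfl⟩
  · exact hfin i
  · rw [Pi.smul_apply, A_tail, A_tail, hfin, tail_smul, hQ, Pi.smul_apply, smul_eq_mul,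
      smul_eq_mul]
    ring

theorem abs_A_fin_le {y : ℕ → ℝ} {C : Fin P.m → ℝ} {q : ℝ} (hC : ∀ j : Fin P.m, |y j| ≤ C j)
    (hq : |P.tailInv (P.tail y) 0| ≤ q) (i : Fin P.m) :
    |P.A y i| ≤ (∑ j, |P.Am i j| * C j) + |P.beta (P.m - 1)| * q * |P.Am i P.last| := by
  rw [A_fin]
  refine (abs_sub _ _).trans (add_le_add ?_ ?_)
  · refine (Finset.abs_sum_le_sum_abs _ _).trans (Finset.sum_le_sum fun j _ => ?_)
    rw [abs_mul]
    exact mul_le_mul_of_nonneg_left (hC j) (abs_nonneg _)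
  · rw [abs_mul, abs_mul, mul_assoc]
    refine mul_le_mul_of_nonneg_left ?_ (abs_nonneg _)
    rw [mul_comm]
    exact mul_le_mul_of_nonneg_right hq (abs_nonneg _)

theorem TailDominant.abs_A_tail_le (H : P.TailDominant) (y : ℕ → ℝ) {E q : ℝ} {n : ℕ}
    (hE : |P.A y P.last| ≤ E) (hq : |P.tailInv (P.tail y) n| ≤ q) :
    |P.A y (P.m + n)| ≤ E * P.eta * (|P.lam P.m| / |P.mu P.m|) * P.theta ^ n + q := by
  rw [A_tail]
  refine (abs_add_le _ _).trans (add_le_add ?_ hq)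
  rw [abs_mul, abs_mul, abs_neg]
  calc |P.lam P.m| * |P.w n| * |P.A y P.last|
      ≤ |P.lam P.m| * (P.eta * P.theta ^ n / |P.b 1|) * E :=
        mul_le_mul (mul_le_mul_of_nonneg_left (H.abs_w_le n) (abs_nonneg _)) hE (abs_nonneg _)
          (mul_nonneg (abs_nonneg _) ((abs_nonneg _).trans (H.abs_w_le n)))
    _ = _ := by
        rw [b_one]
        ring

/-- `A` is bounded from `Ω^{s - s_L}` to `Ω^s`. -/
theorem Assumptions.exists_abs_A_le {C2 : ℝ} {k0 : ℕ} (hA : P.Assumptions C2 k0) (hk0 : k0 ≤ P.m)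
    (hs : 0 ≤ P.s) :
    ∃ C, ∀ (y : ℕ → ℝ) (r : ℝ), (∀ j, |y j| ≤ r / wt (P.s - P.sL) j) →
      ∀ k, |P.A y k| * wt P.s k ≤ C * r := by
  have H := hA.tailDominant hk0
  have hm1 : (1 : ℝ) ≤ P.m := by exact_mod_cast P.m_pos
  obtain ⟨CE, hCE⟩ := exists_sum_pow_mul_rpow_le H.theta_pos H.theta_lt_one P.s hs hm1
  have hCE0 : 0 ≤ CE := (Finset.sum_nonneg fun l _ => mul_nonneg (pow_nonneg H.theta_pos.le _)
    (Real.rpow_nonneg (by positivity) _)).trans (hCE 0)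
  have hth1 : 0 < 1 - P.theta := by linarith [H.theta_lt_one]
  -- This is the single term `l = 0` of the sum bounded by `CE`.
  have hθw : ∀ n, P.theta ^ n * wt P.s (P.m + n) ≤ CE * wt P.s P.m := by
    intro n
    have h := (Finset.single_le_sum (f := fun l : ℕ =>
      P.theta ^ (n - l) * (((P.m : ℝ) + n) / ((P.m : ℝ) + l)) ^ P.s)
      (fun l _ => mul_nonneg (pow_nonneg H.theta_pos.le _) (Real.rpow_nonneg (by positivity) _))
      (Finset.mem_range.2 n.succ_pos)).trans (hCE n)
    rw [Nat.sub_zero, Nat.cast_zero, add_zero, Real.div_rpow (by positivity) (by positivity),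
      ← wt_m_add, ← wt_of_pos P.m_pos, ← mul_div_assoc, div_le_iff₀ (wt_pos _ _)] at h
    exact h
  set q : ℝ := P.eta / P.C1 * (CE + P.theta / (1 - P.theta)) with hq
  have hq0 : 0 ≤ q := mul_nonneg (div_nonneg H.eta_pos.le hA.C1_pos.le)
    (add_nonneg hCE0 (div_nonneg H.theta_pos.le hth1.le))
  set G : Fin P.m → ℝ := fun i => (∑ j, |P.Am i j| * (1 / wt (P.s - P.sL) j))
    + |P.beta (P.m - 1)| * q * |P.Am i P.last| with hG
  have hG0 : ∀ i, 0 ≤ G i := fun i => add_nonneg (Finset.sum_nonneg fun j _ =>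
    mul_nonneg (abs_nonneg _) (one_div_nonneg.2 (wt_pos _ _).le)) (by positivity)
  set S : ℝ := ∑ i, G i with hS
  have hS0 : 0 ≤ S := Finset.sum_nonneg fun i _ => hG0 i
  set R : ℝ := |P.lam P.m| / |P.mu P.m| with hR
  have hR0 : 0 ≤ R := by positivity
  have heta := H.eta_pos.le
  have hwm := (wt_pos P.s P.m).le
  refine ⟨S * wt P.s P.m + (S * P.eta * R * (CE * wt P.s P.m) + q), fun y r hy k => ?_⟩
  have hr : 0 ≤ r := by simpa [wt] using (abs_nonneg _).trans (hy 0)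
  have hQ : ∀ n, |P.tailInv (P.tail y) n| * wt P.s (P.m + n) ≤ q * r := by
    intro n
    have h := hA.abs_tailInv_le hk0 (t := P.s - P.sL) (κ := r) (by linarith) (y := P.tail y)
      (fun n => hy (P.m + n)) n
    rw [sub_add_cancel] at h
    rw [← le_div_iff₀ (wt_pos _ _)]
    refine h.trans ?_
    have h0 : 0 ≤ P.eta * r / (P.C1 * wt P.s (P.m + n)) :=
      div_nonneg (mul_nonneg heta hr) (mul_nonneg hA.C1_pos.le (wt_pos _ _).le)
    refine (mul_le_mul_of_nonneg_left (add_le_add_left (hCE n) _) h0).trans_eq ?_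
    rw [hq]
    field_simp
  have hQ0 : |P.tailInv (P.tail y) 0| ≤ q * r :=
    le_trans (le_mul_of_one_le_right (abs_nonneg _) (one_le_wt hs _)) (hQ 0)
  have hfin : ∀ i : Fin P.m, |P.A y i| ≤ S * r := by
    intro i
    have h := P.abs_A_fin_le (C := fun j => r / wt (P.s - P.sL) j) (fun j => hy j) hQ0 i
    have e : (∑ j : Fin P.m, |P.Am i j| * (r / wt (P.s - P.sL) j))
        + |P.beta (P.m - 1)| * (q * r) * |P.Am i P.last| = G i * r := by
      rw [hG, add_mul, Finset.sum_mul]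
      congr 1
      · exact Finset.sum_congr rfl fun j _ => by ring
      · ring
    rw [e] at h
    exact h.trans (mul_le_mul_of_nonneg_right
      (Finset.single_le_sum (fun i _ => hG0 i) (Finset.mem_univ i)) hr)
  rcases P.eq_fin_or_eq_add k with ⟨i, rfl⟩ | ⟨n, rfl⟩
  · have h1 : |P.A y i| * wt P.s i ≤ S * r * wt P.s P.m :=
      mul_le_mul (hfin i) (wt_mono hs i.2.le) (wt_pos _ _).le (mul_nonneg hS0 hr)
    have h2 : 0 ≤ (S * P.eta * R * (CE * wt P.s P.m) + q) * r := by positivity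
    linarith
  · have h1 := H.abs_A_tail_le y (hfin P.last) (le_refl |P.tailInv (P.tail y) n|)
    have h2 := mul_le_mul_of_nonneg_right h1 (wt_pos P.s (P.m + n)).le
    have h3 : S * r * P.eta * R * (P.theta ^ n * wt P.s (P.m + n))
        ≤ S * r * P.eta * R * (CE * wt P.s P.m) :=
      mul_le_mul_of_nonneg_left (hθw n) (by positivity)
    have h4 := hQ n
    have h5 : 0 ≤ S * wt P.s P.m * r := by positivity
    linarith

/-! ### The bound on `A v` for a decaying sequence `v` -/

/-- In the tail, `A_tail` splits `A v` into a multiple of `w`, which decays geometrically, and the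
tail inverse of `v`, which decays like `ω^{-(s+s_L)}`. Both are eventually below a multiple of
`ω^{-s}` fixed at `m + M`. -/
theorem Assumptions.abs_A_le_Dbound {C2 : ℝ} {k0 : ℕ} (hA : P.Assumptions C2 k0) (hk0 : k0 ≤ P.m)
    (hs : 2 ≤ P.s) (hsL : 0 < P.sL) (hm : 6 ≤ P.m) {M : ℕ} (hMA : P.CondMA M) (hMY : P.CondMY M)
    {v : ℕ → ℝ} {C : Fin P.m → ℝ} {κ : ℝ} (hC : ∀ j : Fin P.m, |v j| ≤ C j)
    (hκ : ∀ n, |v (P.m + n)| ≤ κ / wt P.s (P.m + n)) (k : ℕ) :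
    |P.A v k| ≤ P.Dbound C κ M k := by
  have H := hA.tailDominant hk0
  have hm0 : (0 : ℝ) < P.m := by exact_mod_cast P.m_pos
  have hth1 : 0 < 1 - P.theta := by linarith [H.theta_lt_one]
  have hκ0 : 0 ≤ κ := by
    have := (abs_nonneg _).trans (hκ 0)
    rwa [le_div_iff₀ (wt_pos _ _), zero_mul] at this
  have hηκ : 0 ≤ P.eta * κ := mul_nonneg H.eta_pos.le hκ0
  have hC1 := hA.C1_pos
  have hQ := hA.abs_tailInv_le hk0 (t := P.s) (κ := κ) (by linarith) (y := P.tail v) hκ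
  have hQ0 : |P.tailInv (P.tail v) 0|
      ≤ P.eta * κ / (P.C1 * (1 - P.theta) * wt (P.s + P.sL) P.m) := by
    refine (hQ 0).trans_eq ?_
    have h1 := (wt_pos (P.s + P.sL) P.m).ne'
    simp only [zero_add, Finset.sum_range_one, Nat.sub_self, pow_zero, Nat.cast_zero, add_zero,
      div_self hm0.ne', Real.one_rpow, mul_one]
    field_simp
    ring
  have hfin : ∀ i : Fin P.m, |P.A v i| ≤ (∑ j, |P.Am i j| * C j)
      + |P.beta (P.m - 1)| * P.eta * κ / (P.C1 * (1 - P.theta) * wt (P.s + P.sL) P.m)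
        * |P.Am i P.last| := fun i =>
    (P.abs_A_fin_le hC hQ0 i).trans_eq (by ring)
  have htail : ∀ n, |P.A v (P.m + n)| ≤ P.Dcoupling C κ n
      + P.eta * κ / (P.C1 * wt (P.s + P.sL) (P.m + n))
        * (∑ l ∈ Finset.range (n + 1),
            P.theta ^ (n - l) * (((P.m : ℝ) + n) / ((P.m : ℝ) + l)) ^ (P.s + P.sL)
          + P.theta / (1 - P.theta)) := fun n =>
    (H.abs_A_tail_le v (hfin P.last) (hQ n)).trans_eq (by
      unfold Dcoupling
      ring)
  have hcoup : 0 ≤ ((∑ j, |P.Am P.last j| * C j)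
      + |P.beta (P.m - 1)| * |P.Am P.last P.last| * P.eta * κ
        / (P.C1 * (1 - P.theta) * wt (P.s + P.sL) P.m))
      * P.eta * (|P.lam P.m| / |P.mu P.m|) := by
    have h1 := (abs_nonneg _).trans (hfin P.last)
    refine mul_nonneg (mul_nonneg (h1.trans_eq ?_) H.eta_pos.le) (by positivity)
    ring
  rcases P.eq_fin_or_eq_add k with ⟨i, rfl⟩ | ⟨n, rfl⟩
  · unfold Dbound
    rw [dif_pos i.2]
    exact hfin i
  · unfold Dbound
    rw [dif_neg (by omega), Nat.add_sub_cancel_left]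
    have hfac : 0 ≤ P.eta * κ / (P.C1 * wt (P.s + P.sL) (P.m + n)) :=
      div_nonneg hηκ (mul_nonneg hC1.le (wt_pos _ _).le)
    split_ifs with h1 h2
    · refine (htail n).trans_eq ?_
      push_cast
      rfl
    · subst h2
      refine (htail n).trans ?_
      unfold DatM
      have := H.sum_le_chi hs hsL hm hMA le_rfl
      gcongr
    · have hMn : M ≤ n := by omega
      refine (htail n).trans ?_
      set ρ : ℝ := wt P.s (P.m + M) / wt P.s (P.m + n) with hρ
      have hρ0 : 0 ≤ ρ := div_nonneg (wt_pos _ _).le (wt_pos _ _).le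
      have hc : P.Dcoupling C κ n ≤ P.Dcoupling C κ M * ρ := by
        unfold Dcoupling
        rw [mul_assoc _ (P.theta ^ M)]
        exact mul_le_mul_of_nonneg_left (H.theta_pow_le hs hMY hMn) hcoup
      have hχ := H.sum_le_chi hs hsL hm hMA hMn
      have hχ0 : 0 ≤ P.chi M + P.theta / (1 - P.theta) :=
        add_nonneg ((Finset.sum_nonneg fun l _ => mul_nonneg (pow_nonneg H.theta_pos.le _)
          (Real.rpow_nonneg (by positivity) _)).trans hχ) (div_nonneg H.theta_pos.le hth1.le)
      -- The extra weight `ω^{s_L}` is increasing and is frozen at `m + M`, so that only the ratio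
      -- of the weights `ω^s` remains.
      have hfac2 : P.eta * κ / (P.C1 * wt (P.s + P.sL) (P.m + n))
          ≤ P.eta * κ / (P.C1 * wt (P.s + P.sL) (P.m + M)) * ρ := by
        have hmono : wt P.sL (P.m + M) ≤ wt P.sL (P.m + n) := wt_mono hsL.le (by omega)
        have e : P.eta * κ / (P.C1 * wt (P.s + P.sL) (P.m + M)) * ρ
            = P.eta * κ / (P.C1 * (wt P.s (P.m + n) * wt P.sL (P.m + M))) := by
          have h1 := (wt_pos P.s (P.m + M)).ne'
          have h2 := (wt_pos P.s (P.m + n)).ne'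
          have h3 := (wt_pos P.sL (P.m + M)).ne'
          rw [wt_add, hρ]
          field_simp
        rw [e, wt_add]
        refine div_le_div_of_nonneg_left hηκ
          (mul_pos hC1 (mul_pos (wt_pos _ _) (wt_pos _ _))) ?_
        exact mul_le_mul_of_nonneg_left (mul_le_mul_of_nonneg_left hmono (wt_pos _ _).le) hC1.le
      unfold DatM
      rw [add_mul]
      refine add_le_add hc ?_
      calc _ ≤ P.eta * κ / (P.C1 * wt (P.s + P.sL) (P.m + n))
            * (P.chi M + P.theta / (1 - P.theta)) :=
          mul_le_mul_of_nonneg_left (add_le_add_left hχ _) hfac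
        _ ≤ P.eta * κ / (P.C1 * wt (P.s + P.sL) (P.m + M)) * ρ
            * (P.chi M + P.theta / (1 - P.theta)) := mul_le_mul_of_nonneg_right hfac2 hχ0
        _ = _ := by ring

/-- With `u = r` and `v = r²`, a single application of `abs_A_le_Dbound` yields `D¹ r + D² r²`. -/
theorem Dbound_add_mul (C C' : Fin P.m → ℝ) (κ κ' u v : ℝ) (M k : ℕ) :
    P.Dbound (fun j => C j * u + C' j * v) (κ * u + κ' * v) M k
      = P.Dbound C κ M k * u + P.Dbound C' κ' M k * v := by
  have hsum : ∀ i, ∑ j, |P.Am i j| * (C j * u + C' j * v)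
      = (∑ j, |P.Am i j| * C j) * u + (∑ j, |P.Am i j| * C' j) * v := by
    intro i
    rw [Finset.sum_mul, Finset.sum_mul, ← Finset.sum_add_distrib]
    exact Finset.sum_congr rfl fun j _ => by ring
  have hcoup : ∀ n, P.Dcoupling (fun j => C j * u + C' j * v) (κ * u + κ' * v) n
      = P.Dcoupling C κ n * u + P.Dcoupling C' κ' n * v := by
    intro n
    unfold Dcoupling
    rw [hsum]
    ring
  unfold Dbound DatM
  simp only [hcoup, hsum]
  split_ifs <;> ring

/-! ### The operator `A A†` -/

theorem tri_m_add_succ (z : ℕ → ℝ) (n : ℕ) :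
    P.tri z (P.m + (n + 1)) = P.a (n + 2) * z (P.m + n) + P.b (n + 2) * z (P.m + (n + 1))
      + P.c (n + 2) * z (P.m + (n + 2)) := rfl

theorem tri_m (z : ℕ → ℝ) :
    P.tri z P.m = P.lam P.m * z (P.m - 1) + P.b 1 * z P.m + P.c 1 * z (P.m + 1) := by
  obtain ⟨k, hk⟩ : ∃ k, P.m = k + 1 := ⟨P.m - 1, by have := P.m_pos; omega⟩
  rw [b_one, c_one, hk]
  rfl

theorem tail_Adag (z : ℕ → ℝ) (n : ℕ) : P.tail (P.Adag z) n = P.tri z (P.m + n) := by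
  simp [tail, Adag]

theorem Adag_fin (z : ℕ → ℝ) (i : Fin P.m) :
    P.Adag z i = (∑ j, P.D i j * z j) + if i = P.last then P.beta (P.m - 1) * z P.m else 0 := by
  have h : ((i : ℕ) = P.m - 1) ↔ i = P.last := by
    rw [Fin.ext_iff]
    rfl
  simp [Adag, h]

/-- The tail of `A† z` is the tridiagonal tail applied to `z_I` plus `λ_m z_{m-1} e_1`. The inverse
recovers `z_I` from the first part and turns `e_1` into `w`. -/
theorem TailDominant.tailInv_tail_Adag (H : P.TailDominant) {z : ℕ → ℝ} {B : ℝ}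
    (hz : ∀ n, |z n| ≤ B) (k : ℕ) :
    P.tailInv (P.tail (P.Adag z)) k = P.lam P.m * z (P.m - 1) * P.w k + z (P.m + k) := by
  set e : ℕ → ℝ := Pi.single 0 1 with he
  set y : ℕ → ℝ := fun n => P.tri z (P.m + n) - P.lam P.m * z (P.m - 1) * e n with hy
  have hsplit : P.tail (P.Adag z) = (P.lam P.m * z (P.m - 1)) • e + y := by
    funext n
    rw [tail_Adag]
    simp [hy]
  have hinv : P.tailInv y = fun n => z (P.m + n) := by
    funext n
    refine H.tailInv_tridiag (z := fun n => z (P.m + n)) (fun n => hz _) ?_ (fun n => ?_) n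
    · simp only [hy, he, add_zero, Pi.single_eq_same, mul_one, tri_m]
      ring
    · simp only [hy, he, Pi.single_eq_of_ne n.succ_ne_zero, mul_zero, sub_zero]
      rw [tri_m_add_succ]
  -- Additivity of the tail inverse needs this bound: a row has at most three terms, each at most
  -- `|b| B`, and the pivot is at least `γ|b|`.
  have hyb : ∀ n, |y n / P.piv n| ≤ 3 * B * (1 / P.gamma) := by
    have hg := gamma_pos P
    have hB : 0 ≤ B := (abs_nonneg _).trans (hz 0)
    have hd := H.delta_pos
    have key : ∀ n u, |u| ≤ |P.b (n + 1)| * (3 * B) →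
        |u / P.piv n| ≤ 3 * B * (1 / P.gamma) := by
      intro n u hu
      rw [abs_div, div_le_iff₀ (abs_pos.2 (H.piv_ne_zero n))]
      have h1 := H.le_abs_piv n
      calc |u| ≤ |P.b (n + 1)| * (3 * B) := hu
        _ = 3 * B * (1 / P.gamma) * (P.gamma * |P.b (n + 1)|) := by field_simp
        _ ≤ _ := mul_le_mul_of_nonneg_left h1 (by positivity)
    have hco : ∀ n x j, |x| ≤ P.delta * |P.b (n + 1)| → |x * z j| ≤ |P.b (n + 1)| * B := by
      intro n x j hx
      rw [abs_mul]
      refine mul_le_mul (hx.trans (mul_le_of_le_one_left (abs_nonneg _) ?_)) (hz j)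
        (abs_nonneg _) (abs_nonneg _)
      linarith [H.delta_lt]
    have hbo : ∀ n j, |P.b (n + 1) * z j| ≤ |P.b (n + 1)| * B := fun n j => by
      rw [abs_mul]
      exact mul_le_mul_of_nonneg_left (hz j) (abs_nonneg _)
    intro n
    refine key n _ ?_
    cases n with
    | zero =>
      have e0 : y 0 = P.b 1 * z P.m + P.c 1 * z (P.m + 1) := by
        simp only [hy, he, add_zero, Pi.single_eq_same, mul_one, tri_m]
        ring
      rw [e0]
      have h1 := hbo 0 P.m
      have h2 := hco 0 _ (P.m + 1) (H.abs_c_le 0)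
      have h3 := abs_add_le (P.b 1 * z P.m) (P.c 1 * z (P.m + 1))
      have h4 : 0 ≤ |P.b (0 + 1)| * B := by positivity
      simp only [zero_add] at *
      linarith
    | succ n =>
      have e1 : y (n + 1) = P.a (n + 2) * z (P.m + n) + P.b (n + 2) * z (P.m + (n + 1))
          + P.c (n + 2) * z (P.m + (n + 2)) := by
        simp only [hy, he, Pi.single_eq_of_ne n.succ_ne_zero, mul_zero, sub_zero]
        rw [tri_m_add_succ]
      rw [e1]
      have h1 := hbo (n + 1) (P.m + (n + 1))
      have h2 := hco (n + 1) _ (P.m + (n + 2)) (H.abs_c_le (n + 1))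
      have h3 := hco (n + 1) _ (P.m + n) (H.abs_a_le (n + 1))
      have h4 := abs_add_three (P.a (n + 2) * z (P.m + n)) (P.b (n + 2) * z (P.m + (n + 1)))
        (P.c (n + 2) * z (P.m + (n + 2)))
      linarith
  have hsb : ∀ n, |((P.lam P.m * z (P.m - 1)) • e) n / P.piv n|
      ≤ |P.lam P.m * z (P.m - 1)| * (1 / |P.b 1|) := by
    intro n
    rw [Pi.smul_apply, smul_eq_mul, mul_div_assoc, abs_mul]
    exact mul_le_mul_of_nonneg_left
      ((abs_single_div_piv_le n).trans (single_le n)) (abs_nonneg _)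
  rw [hsplit, H.tailInv_add hsb hyb, Pi.add_apply, hinv,
    H.tailInv_smul _ fun n => (abs_single_div_piv_le n).trans (single_le n), Pi.smul_apply,
    smul_eq_mul]
  rfl

/-- The coupling `β_{m-1} z_m` in `A†` cancels against the `z_m` inside the tail inverse. What is
left of the latter, `β_{m-1} λ_m w_0 z_{m-1}`, is the correction in `K̃` up to replacing `w_0` by
`w̃`. -/
theorem TailDominant.sub_A_Adag_fin (H : P.TailDominant) {z : ℕ → ℝ} {B : ℝ}
    (hz : ∀ n, |z n| ≤ B) (i : Fin P.m) :
    z i - P.A (P.Adag z) i = (∑ j, (1 - P.Am * P.Ktilde) i j * z j)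
      + P.beta (P.m - 1) * P.lam P.m * (P.w 0 - P.wtilde) * P.Am i P.last * z P.last := by
  have hK : ∀ i, ∑ j, P.Ktilde i j * z j
      = P.Adag z i - (if i = P.last then P.beta (P.m - 1) * z P.m else 0)
        - (if i = P.last then P.beta (P.m - 1) * P.lam P.m * P.wtilde * z P.last else 0) := by
    intro i
    rw [Adag_fin, add_sub_cancel_right]
    simp only [Ktilde, Matrix.sub_apply, Matrix.smul_apply, smul_eq_mul, sub_mul,
      Finset.sum_sub_distrib]
    congr 1
    rw [Finset.sum_eq_single P.last]
    · by_cases h : i = P.last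
      · rw [if_pos h, h, Matrix.single_apply_same]
      · rw [if_neg h, Matrix.single_apply_of_row_ne (Ne.symm h)]
        ring
    · intro j _ hj
      rw [Matrix.single_apply_of_col_ne _ _ (Ne.symm hj)]
      ring
    · simp
  have h1 : ∑ j, (1 - P.Am * P.Ktilde) i j * z j
      = z i - ∑ j, P.Am i j * ∑ l, P.Ktilde j l * z l := by
    have h2 := congrFun (Matrix.sub_mulVec 1 (P.Am * P.Ktilde) fun j : Fin P.m => z j) i
    rw [Matrix.one_mulVec, ← Matrix.mulVec_mulVec] at h2
    exact h2
  have hlast : z (P.m - 1) = z P.last := rfl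
  rw [h1, A_fin, H.tailInv_tail_Adag hz]
  simp only [hK, mul_sub, Finset.sum_sub_distrib, mul_ite, mul_zero, Finset.sum_ite_eq',
    Finset.mem_univ, if_true, add_zero, hlast]
  ring

theorem TailDominant.sub_A_Adag_tail (H : P.TailDominant) {z : ℕ → ℝ} {B : ℝ}
    (hz : ∀ n, |z n| ≤ B) (n : ℕ) :
    z (P.m + n) - P.A (P.Adag z) (P.m + n)
      = -P.lam P.m * P.w n * (z P.last - P.A (P.Adag z) P.last) := by
  have hlast : z (P.m - 1) = z P.last := rfl
  rw [A_tail, H.tailInv_tail_Adag hz, hlast]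
  ring

theorem TailDominant.abs_sub_A_Adag_le (H : P.TailDominant) (hs : 2 ≤ P.s) {M : ℕ}
    (hMY : P.CondMY M) {z : ℕ → ℝ} {r : ℝ} (hz : ∀ k, |z k| ≤ r / wt P.s k) (k : ℕ) :
    |z k - P.A (P.Adag z) k| ≤ P.Z1 M r k := by
  have hr : 0 ≤ r := by simpa [wt] using (abs_nonneg _).trans (hz 0)
  have hs0 : 0 ≤ P.s := by linarith
  have hzB : ∀ n, |z n| ≤ r := fun n => (hz n).trans (div_le_self hr (one_le_wt hs0 n))
  have hmu := H.b_ne_zero 0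
  rw [zero_add, b_one] at hmu
  have hfin : ∀ i : Fin P.m, |z i - P.A (P.Adag z) i|
      ≤ (P.defect i + P.truncErr * |P.Am i P.last|) * r := by
    intro i
    rw [H.sub_A_Adag_fin hzB, add_mul]
    refine (abs_add_le _ _).trans (add_le_add ?_ ?_)
    · unfold defect
      rw [Finset.sum_mul]
      refine (Finset.abs_sum_le_sum_abs _ _).trans (Finset.sum_le_sum fun j _ => ?_)
      rw [abs_mul, mul_assoc, one_div_mul_eq_div]
      exact mul_le_mul_of_nonneg_left (hz j) (abs_nonneg _)
    · have hw := H.abs_w_zero_sub_wtilde_le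
      rw [b_one] at hw
      simp only [abs_mul]
      have hzl : |z P.last| ≤ r / wt P.s (P.m - 1) := hz (P.m - 1)
      calc |P.beta (P.m - 1)| * |P.lam P.m| * |P.w 0 - P.wtilde| * |P.Am i P.last| * |z P.last|
          ≤ |P.beta (P.m - 1)| * |P.lam P.m|
            * (P.theta ^ (2 * P.L) / (|P.mu P.m| * (1 - P.theta ^ 2))) * |P.Am i P.last|
            * (r / wt P.s (P.m - 1)) := by
            have h0 := (abs_nonneg _).trans hw
            gcongr
        _ = _ := by
            unfold truncErr
            have h1 := H.one_sub_theta_sq_pos.ne'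
            have h2 := (wt_pos P.s (P.m - 1)).ne'
            have h3 := abs_ne_zero.2 hmu
            field_simp
  have htail : ∀ n, |z (P.m + n) - P.A (P.Adag z) (P.m + n)| ≤ P.Z1tail r n := by
    intro n
    rw [H.sub_A_Adag_tail hzB, abs_mul, abs_mul, abs_neg]
    have hw := H.abs_w_le n
    rw [b_one] at hw
    calc |P.lam P.m| * |P.w n| * |z P.last - P.A (P.Adag z) P.last|
        ≤ |P.lam P.m| * (P.eta * P.theta ^ n / |P.mu P.m|)
          * ((P.defect P.last + P.truncErr * |P.Am P.last P.last|) * r) := by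
          have h0 := (abs_nonneg _).trans hw
          gcongr
          exact hfin P.last
      _ = _ := by
          unfold Z1tail
          ring
  rcases P.eq_fin_or_eq_add k with ⟨i, rfl⟩ | ⟨n, rfl⟩
  · unfold Z1
    rw [dif_pos i.2]
    exact hfin i
  · unfold Z1
    rw [dif_neg (by omega), Nat.add_sub_cancel_left]
    split_ifs with h
    · exact htail n
    · refine (htail n).trans ?_
      unfold Z1tail
      have h0 := (abs_nonneg _).trans (hfin P.last)
      have h1 := H.theta_pow_le hs hMY (not_le.1 h).le
      have h2 := mul_le_mul_of_nonneg_left h1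
        (mul_nonneg h0 (mul_nonneg H.eta_pos.le
          (by positivity : 0 ≤ |P.lam P.m| / |P.mu P.m|)))
      linarith

/-! ### Differentiability of `f` and `T` -/

theorem tri_add (x y : ℕ → ℝ) : P.tri (x + y) = P.tri x + P.tri y := by
  funext k
  cases k <;> simp only [tri, Pi.add_apply] <;> ring

theorem tri_smul (r : ℝ) (x : ℕ → ℝ) : P.tri (r • x) = r • P.tri x := by
  funext k
  cases k <;> simp only [tri, Pi.smul_apply, smul_eq_mul] <;> ring

theorem Assumptions.abs_tri_le {C2 : ℝ} {k0 : ℕ} (hA : P.Assumptions C2 k0) (hs : 0 ≤ P.s)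
    (x : Omega P.s) (k : ℕ) :
    |P.tri x.seq k| * wt (P.s - P.sL) k ≤ C2 * (2 ^ P.s + 2) * ‖x‖ := by
  have hC2 : 0 ≤ C2 := hA.C1_pos.le.trans hA.C1_le_C2
  have hn := norm_nonneg x
  have h2s : (0 : ℝ) ≤ 2 ^ P.s := by positivity
  -- A coefficient costs `ω^{s_L}`, and moving the weight from `k` to a neighbour `j` costs `D`: `1`
  -- for the diagonal and superdiagonal, `2^s` for the subdiagonal.
  have hco : ∀ (a D : ℝ) (k j : ℕ), |a / wt P.sL k| ≤ C2 → wt P.s k ≤ D * wt P.s j →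
      |a * x.seq j| * wt (P.s - P.sL) k ≤ C2 * D * ‖x‖ := by
    intro a D k j ha hD
    have hw : wt P.s k = wt (P.s - P.sL) k * wt P.sL k := by
      rw [← wt_add, sub_add_cancel]
    have h1 := wt_pos P.sL k
    have h2 := x.abs_seq_mul_wt_le j
    rw [abs_div, abs_of_pos h1, div_le_iff₀ h1] at ha
    have hD0 : 0 ≤ D := by
      by_contra hneg
      nlinarith [wt_pos P.s k, wt_pos P.s j]
    calc |a * x.seq j| * wt (P.s - P.sL) k
        ≤ C2 * wt P.sL k * |x.seq j| * wt (P.s - P.sL) k := by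
          rw [abs_mul]
          have := wt_pos (P.s - P.sL) k
          gcongr
      _ = C2 * |x.seq j| * wt P.s k := by
          rw [hw]
          ring
      _ ≤ C2 * |x.seq j| * (D * wt P.s j) := by gcongr
      _ = C2 * D * (|x.seq j| * wt P.s j) := by ring
      _ ≤ _ := by gcongr
  have hw0 := (wt_pos (P.s - P.sL) k).le
  cases k with
  | zero =>
    have h1 := hco _ 1 0 0 (hA.mu_le 0) (by rw [one_mul])
    have h2 := hco _ 1 0 1 (hA.beta_le 0) (by simp [wt])
    have h3 := mul_le_mul_of_nonneg_right
      (abs_add_le (P.mu 0 * x.seq 0) (P.beta 0 * x.seq 1)) hw0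
    have h4 : 0 ≤ C2 * 2 ^ P.s * ‖x‖ := by positivity
    simp only [tri]
    linarith
  | succ k =>
    have h1 := hco _ (2 ^ P.s) (k + 1) k (hA.lam_le (k + 1)) (wt_succ_le hs k)
    have h2 := hco _ 1 (k + 1) (k + 1) (hA.mu_le (k + 1)) (by rw [one_mul])
    have h3 := hco _ 1 (k + 1) (k + 2) (hA.beta_le (k + 1))
      (by rw [one_mul]; exact wt_mono hs (by omega))
    have h4 := mul_le_mul_of_nonneg_right (abs_add_three (P.lam (k + 1) * x.seq k)
      (P.mu (k + 1) * x.seq (k + 1)) (P.beta (k + 1) * x.seq (k + 2))) hw0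
    simp only [tri]
    linarith

variable (P) in
/-- The tridiagonal operator as a linear map on `Ω^s`. -/
noncomputable def triLin : Omega P.s →ₗ[ℝ] (ℕ → ℝ) where
  toFun x := P.tri x.seq
  map_add' x y := P.tri_add x.seq y.seq
  map_smul' r x := P.tri_smul r x.seq

/-- The quadratic part is the bounded bilinear convolution on the diagonal, so the product rule
applies, and `conv_comm` merges its two terms into `2σ x * z`. The inclusion into `Ω^{s-s_L}` puts
all parts in one space. -/
theorem Assumptions.exists_hasFDerivAt_f {C2 : ℝ} {k0 : ℕ} (hA : P.Assumptions C2 k0)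
    (hs : 2 ≤ P.s) (hsL : 0 < P.sL) (hg : MemOmega P.s P.g) :
    ∃ hf : ∀ x : Omega P.s, MemOmega (P.s - P.sL) (P.f x.seq),
      ∀ x : Omega P.s, ∃ F' : Omega P.s →L[ℝ] Omega (P.s - P.sL),
        HasFDerivAt (fun x : Omega P.s => Omega.mk (P.f x.seq) (hf x)) F' x ∧
        ∀ z, (F' z).seq = P.tri z.seq + (2 * P.sigma) • conv x.seq z.seq := by
  have hle : P.s - P.sL ≤ P.s := by linarith
  have hb := isBoundedBilinearMap_conv hs
  set Lc : Omega P.s →L[ℝ] Omega (P.s - P.sL) :=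
    Omega.clm P.triLin _ (hA.abs_tri_le (by linarith)) with hLc
  set F : Omega P.s → Omega (P.s - P.sL) := fun x =>
    Lc x + Omega.incl hle (P.sigma • Omega.mk (conv x.seq x.seq) (memOmega_conv hs x.mem x.mem)
      + Omega.mk P.g hg) with hF
  have hFf : ∀ x, (F x).seq = P.f x.seq := fun x => rfl
  have hf : ∀ x : Omega P.s, MemOmega (P.s - P.sL) (P.f x.seq) := fun x => hFf x ▸ (F x).mem
  refine ⟨hf, fun x => ⟨Lc + (Omega.incl hle).comp (P.sigma •
    (hb.deriv (x, x)).comp ((ContinuousLinearMap.id ℝ (Omega P.s)).prod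
      (ContinuousLinearMap.id ℝ (Omega P.s)))), ?_, fun z => ?_⟩⟩
  · have hdiag : HasFDerivAt (fun x : Omega P.s => (x, x))
        ((ContinuousLinearMap.id ℝ (Omega P.s)).prod (ContinuousLinearMap.id ℝ (Omega P.s))) x :=
      (hasFDerivAt_id x).prodMk (hasFDerivAt_id x)
    have h1 := HasFDerivAt.comp (f := fun x : Omega P.s => (x, x)) x
      (hb.hasFDerivAt (x, x)) hdiag
    exact Lc.hasFDerivAt.add
      ((Omega.incl hle).hasFDerivAt.comp x ((h1.const_smul P.sigma).add_const (Omega.mk P.g hg)))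
  · funext k
    have h2 : conv z.seq x.seq = conv x.seq z.seq := conv_comm _ _
    change P.tri z.seq k + P.sigma * (conv x.seq z.seq k + conv z.seq x.seq k) = _
    rw [h2]
    simp only [Pi.add_apply, Pi.smul_apply, smul_eq_mul]
    ring

theorem Assumptions.exists_clm_A {C2 : ℝ} {k0 : ℕ} (hA : P.Assumptions C2 k0) (hk0 : k0 ≤ P.m)
    (hs : 0 ≤ P.s) :
    ∃ Ac : Omega (P.s - P.sL) →L[ℝ] Omega P.s, ∀ y, (Ac y).seq = P.A y.seq := by
  obtain ⟨C, hC⟩ := hA.exists_abs_A_le hk0 hs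
  exact ⟨Omega.clm
    { toFun := fun y => P.A y.seq
      map_add' := fun y z => hA.A_add hk0 hs y.mem z.mem
      map_smul' := fun r y => hA.A_smul hk0 hs r y.mem } C
    fun y => hC y.seq ‖y‖ fun j => Omega.abs_seq_le le_rfl j, fun y => rfl⟩

/-! ### The Jacobian matrix of the truncation -/

variable (P) in
/-- `x_F ↦ (x_F, 0, 0, …)` as a linear map into `Ω^s`. -/
noncomputable def padLin : (Fin P.m → ℝ) →ₗ[ℝ] Omega P.s where
  toFun x := Omega.mk (P.pad x) (P.memOmega_pad P.s x)
  map_add' x y := Omega.ext fun k => by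
    simp only [Omega.seq_mk, Omega.seq_add, Pi.add_apply, pad]
    split_ifs <;> simp
  map_smul' r x := Omega.ext fun k => by
    simp only [Omega.seq_mk, Omega.seq_smul, Pi.smul_apply, pad, RingHom.id_apply]
    split_ifs <;> simp

/-- The truncation is coordinates after `f` after padding by zeros, so the chain rule reads `D` off
the derivative of `f` at `x̄`. -/
theorem Assumptions.sum_D_mul {C2 : ℝ} {k0 : ℕ} (hA : P.Assumptions C2 k0)
    (hs : 2 ≤ P.s) (hsL : 0 < P.sL) (hg : MemOmega P.s P.g) (v : Fin P.m → ℝ) (i : Fin P.m) :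
    ∑ j, P.D i j * v j
      = P.tri (P.pad v) i + 2 * P.sigma * conv (P.pad P.xbar) (P.pad v) i := by
  obtain ⟨hf, hF⟩ := hA.exists_hasFDerivAt_f hs hsL hg
  obtain ⟨F', hF', hFz⟩ := hF P.xbarOmega
  set pc : (Fin P.m → ℝ) →L[ℝ] Omega P.s := LinearMap.toContinuousLinearMap P.padLin with hpc
  have hpcx : pc P.xbar = P.xbarOmega := rfl
  have hd : HasFDerivAt P.fm (ContinuousLinearMap.pi fun i : Fin P.m =>
      (Omega.coord (P.s - P.sL) i).comp (F'.comp pc)) P.xbar := by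
    rw [hasFDerivAt_pi]
    intro i
    have h1 : HasFDerivAt (fun x : Omega P.s => Omega.mk (P.f x.seq) (hf x)) F' (pc P.xbar) := hF'
    exact (Omega.coord (P.s - P.sL) i).hasFDerivAt.comp P.xbar (h1.comp P.xbar pc.hasFDerivAt)
  have h2 := congrFun (LinearMap.toMatrix'_mulVec
    (fderiv ℝ P.fm P.xbar : (Fin P.m → ℝ) →ₗ[ℝ] (Fin P.m → ℝ)) v) i
  have h3 : ∑ j, P.D i j * v j = (F' (pc v)).seq i := by
    refine (show ∑ j, P.D i j * v j = fderiv ℝ P.fm P.xbar v i from h2).trans ?_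
    rw [hd.fderiv]
    rfl
  rw [h3, hFz]
  rfl

/-! ### The difference `Df(x̄ + y) - A†` in the finite and in the tail rows -/

variable (P) in
/-- The tail part `(0, …, 0, z_m, z_{m+1}, …)` of `z`. -/
noncomputable def dropFin (z : ℕ → ℝ) (k : ℕ) : ℝ :=
  if k < P.m then 0 else z k

theorem pad_add_dropFin (z : ℕ → ℝ) : P.pad (fun j => z j) + P.dropFin z = z := by
  funext k
  simp only [Pi.add_apply, pad, dropFin]
  split_ifs <;> simp

/-- Only the last finite row of `𝓛` sees the tail. The missing term is the one added in `A†`, so no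
tridiagonal part survives in the finite rows of `Df - A†`. -/
theorem tri_pad_add (z : ℕ → ℝ) (i : Fin P.m) :
    P.tri (P.pad fun j => z j) i + (if i = P.last then P.beta (P.m - 1) * z P.m else 0)
      = P.tri z i := by
  have hpad : ∀ k, k < P.m → P.pad (fun j => z j) k = z k := fun k hk => by simp [pad, hk]
  have hi := i.2
  have hlast : i = P.last ↔ (i : ℕ) + 1 = P.m := by
    rw [Fin.ext_iff]
    change (i : ℕ) = P.m - 1 ↔ _
    omega
  have hbeta : ∀ k, k + 1 = P.m → P.beta (P.m - 1) = P.beta k := fun k hk => by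
    rw [← hk, Nat.add_sub_cancel]
  have hnext : ∀ k, k < P.m → P.beta k * P.pad (fun j => z j) (k + 1)
      + (if k + 1 = P.m then P.beta (P.m - 1) * z P.m else 0) = P.beta k * z (k + 1) := by
    intro k hk
    split_ifs with h
    · rw [hbeta k h, h]
      simp [pad]
    · rw [hpad _ (by omega), add_zero]
  simp only [hlast]
  have hn := hnext i hi
  generalize (i : ℕ) = k at *
  cases k with
  | zero =>
    simp only [tri, hpad 0 hi]
    rw [add_assoc]
    simp only [zero_add] at hn ⊢
    rw [hn]
  | succ k =>
    simp only [tri, hpad (k + 1) hi, hpad k (by omega)]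
    rw [add_assoc, show k + 2 = k + 1 + 1 from rfl, hn]

theorem Assumptions.Adag_fin_eq {C2 : ℝ} {k0 : ℕ} (hA : P.Assumptions C2 k0)
    (hs : 2 ≤ P.s) (hsL : 0 < P.sL) (hg : MemOmega P.s P.g) (z : ℕ → ℝ) (i : Fin P.m) :
    P.Adag z i
      = P.tri z i + 2 * P.sigma * conv (P.pad P.xbar) (P.pad fun j => z j) i := by
  rw [Adag_fin, hA.sum_D_mul hs hsL hg fun j => z j, ← P.tri_pad_add z i]
  ring

/-- A nonzero term needs `|j| < m` and `|i - j| ≥ m`. For `0 ≤ i < m` this forces `j = -l` with `m -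
i ≤ l ≤ m - 1`. -/
theorem conv_pad_dropFin (x : Fin P.m → ℝ) (z : ℕ → ℝ) (i : Fin P.m) :
    conv (P.pad x) (P.dropFin z) i
      = ∑ l ∈ Finset.Icc (P.m - i) (P.m - 1), P.pad x l * z (i + l) := by
  have hinj : Function.Injective fun l : ℕ => -(l : ℤ) := fun a b h => by simpa using h
  have hi := i.2
  unfold conv
  rw [tsum_eq_sum (s := (Finset.Icc (P.m - i) (P.m - 1)).image fun l : ℕ => -(l : ℤ)),
    Finset.sum_image fun a _ b _ h => hinj h]
  · refine Finset.sum_congr rfl fun l hl => ?_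
    rw [Finset.mem_Icc] at hl
    rw [show (-(l : ℤ)).natAbs = l by omega,
      show (((i : ℕ) : ℤ) - -(l : ℤ)).natAbs = i + l by omega, dropFin, if_neg (by omega)]
  · intro j hj
    rcases Nat.lt_or_ge j.natAbs P.m with h1 | h1
    · rcases Nat.lt_or_ge (((i : ℕ) : ℤ) - j).natAbs P.m with h2 | h2
      · rw [dropFin, if_pos h2, mul_zero]
      · refine absurd (Finset.mem_image.2 ⟨j.natAbs, ?_, ?_⟩) hj
        · rw [Finset.mem_Icc]
          omega
        · omega
    · rw [pad, dif_neg (by omega), zero_mul]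

theorem abs_conv_pad_dropFin_le (x : Fin P.m → ℝ) {z : ℕ → ℝ} {r : ℝ}
    (hz : ∀ k, |z k| ≤ r / wt P.s k) (i : Fin P.m) :
    |conv (P.pad x) (P.dropFin z) i|
      ≤ (∑ l ∈ Finset.Icc (P.m - i) (P.m - 1), |P.pad x l| / wt P.s (i + l)) * r := by
  rw [conv_pad_dropFin, Finset.sum_mul]
  refine (Finset.abs_sum_le_sum_abs _ _).trans (Finset.sum_le_sum fun l _ => ?_)
  rw [abs_mul, div_mul_eq_mul_div, mul_div_assoc]
  exact mul_le_mul_of_nonneg_left (hz _) (abs_nonneg _)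

/-- `A† z` differs from `𝓛 z` in finitely many entries only. -/
theorem Assumptions.memOmega_Adag {C2 : ℝ} {k0 : ℕ} (hA : P.Assumptions C2 k0) (hs : 0 ≤ P.s)
    (z : Omega P.s) : MemOmega (P.s - P.sL) (P.Adag z.seq) := by
  have htri : MemOmega (P.s - P.sL) (P.tri z.seq) := memOmega_iff.2 ⟨_, hA.abs_tri_le hs z⟩
  have e : P.Adag z.seq
      = P.tri z.seq + P.pad fun i => P.Adag z.seq i - P.tri z.seq i := by
    funext k
    rw [Pi.add_apply]
    rcases P.eq_fin_or_eq_add k with ⟨i, rfl⟩ | ⟨n, rfl⟩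
    · simp [pad]
    · have := P.tail_Adag z.seq n
      rw [tail] at this
      simp [pad, this]
  rw [e]
  exact htri.add (P.memOmega_pad _ _)

/-- The bound on `A (Df(x̄ + y) - A†) z`. -/
theorem Assumptions.abs_A_sub_Adag_le {C2 : ℝ} {k0 : ℕ} (hA : P.Assumptions C2 k0)
    (hk0 : k0 ≤ P.m) (hs : 2 ≤ P.s) (hsL : 0 < P.sL) (hg : MemOmega P.s P.g) (hm : 6 ≤ P.m)
    (hN : 1 ≤ P.N) {M : ℕ} (hMA : P.CondMA M) (hMY : P.CondMY M) {y z : Omega P.s} {r : ℝ}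
    (hy : ‖y‖ ≤ r) (hz : ‖z‖ ≤ r) (k : ℕ) :
    |P.A (P.tri z.seq + (2 * P.sigma) • conv (P.xbarOmega + y).seq z.seq - P.Adag z.seq) k|
      ≤ P.Z2 M r k := by
  have hs1 : 1 < P.s := by linarith
  have hyk := Omega.abs_seq_le hy
  have hzk := Omega.abs_seq_le hz
  have h2σ : 0 ≤ 2 * |P.sigma| := by positivity
  have habs2 : |2 * P.sigma| = 2 * |P.sigma| := by rw [abs_mul, abs_two]
  have hconv : conv (P.xbarOmega + y).seq z.seq
      = conv (P.pad P.xbar) z.seq + conv y.seq z.seq :=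
    conv_add_left hs1 (P.memOmega_pad _ _) y.mem z.mem
  have hxk : ∀ k, |P.pad P.xbar k| ≤ omegaNorm P.s (P.pad P.xbar) / wt P.s k :=
    (P.memOmega_pad P.s P.xbar).abs_le
  unfold Z2 D1 D2
  rw [← Dbound_add_mul]
  refine hA.abs_A_le_Dbound hk0 hs hsL hm hMA hMY (fun i => ?_) (fun n => ?_) k
  · have hdrop : MemOmega P.s (P.dropFin z.seq) := by
      have : P.dropFin z.seq = z.seq - P.pad fun j => z.seq j :=
        eq_sub_of_add_eq' (P.pad_add_dropFin z.seq)
      rw [this]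
      exact z.mem.sub (P.memOmega_pad _ _)
    have hsplit : conv (P.pad P.xbar) z.seq
        = conv (P.pad P.xbar) (P.pad fun j => z.seq j)
          + conv (P.pad P.xbar) (P.dropFin z.seq) := by
      rw [conv_comm _ (P.pad fun j => z.seq j), conv_comm _ (P.dropFin z.seq),
        ← conv_add_left hs1 (P.memOmega_pad _ _) hdrop (P.memOmega_pad _ _),
        P.pad_add_dropFin, conv_comm]
    -- The matrix `D` already contains the convolution of `x̄` with `z_F`, so `x̄` meets only the
    -- tail of `z`. In the tail rows `A†` has no convolution, and the full `x̄ * z` remains.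
    have e : (P.tri z.seq + (2 * P.sigma) • conv (P.xbarOmega + y).seq z.seq - P.Adag z.seq) i
        = 2 * P.sigma * (conv (P.pad P.xbar) (P.dropFin z.seq) i + conv y.seq z.seq i) := by
      rw [Pi.sub_apply, hA.Adag_fin_eq hs hsL hg, hconv, hsplit]
      simp only [Pi.add_apply, Pi.smul_apply, smul_eq_mul]
      ring
    rw [e, abs_mul, habs2]
    have h1 := P.abs_conv_pad_dropFin_le P.xbar hzk i
    have h2 := abs_conv_le hs hm hN hyk hzk i
    refine (mul_le_mul_of_nonneg_left ((abs_add_le _ _).trans (add_le_add h1 h2)) h2σ).trans_eq ?_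
    unfold C1F C2F
    ring
  · have e : (P.tri z.seq + (2 * P.sigma) • conv (P.xbarOmega + y).seq z.seq - P.Adag z.seq)
        (P.m + n)
        = 2 * P.sigma * (conv (P.pad P.xbar) z.seq (P.m + n) + conv y.seq z.seq (P.m + n)) := by
      have h := P.tail_Adag z.seq n
      rw [tail] at h
      rw [Pi.sub_apply, h, hconv]
      simp only [Pi.add_apply, Pi.smul_apply, smul_eq_mul]
      ring
    rw [e, abs_mul, habs2]
    have h1 := abs_conv_le hs hm hN hxk hzk (P.m + n)
    have h2 := abs_conv_le hs hm hN hyk hzk (P.m + n)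
    rw [alpha_of_le P.m_pos (Nat.le_add_right _ _)] at h1 h2
    refine (mul_le_mul_of_nonneg_left ((abs_add_le _ _).trans (add_le_add h1 h2)) h2σ).trans_eq ?_
    ring

end Data

end TridiagNewton

theorem mainTheorem4 (P : TridiagNewton.Data) (C2 : ℝ) (k0 : ℕ)
    (hs : 2 ≤ P.s) (hsL : 0 < P.sL) (hg : TridiagNewton.MemOmega P.s P.g)
    (hA : P.Assumptions C2 k0) (hk0 : k0 ≤ P.m) (hm : 6 ≤ P.m) (hN : 1 ≤ P.N)
    (M : ℕ) (hMA : P.CondMA M) (hMY : P.CondMY M) :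
    ∃ (hf : ∀ x : TridiagNewton.Omega P.s, TridiagNewton.MemOmega (P.s - P.sL) (P.f x.seq))
      (hT : ∀ x : TridiagNewton.Omega P.s, TridiagNewton.MemOmega P.s (P.T x.seq)),
      Differentiable ℝ (fun x : TridiagNewton.Omega P.s => TridiagNewton.Omega.mk (P.f x.seq) (hf x)) ∧
      Differentiable ℝ (fun x : TridiagNewton.Omega P.s => TridiagNewton.Omega.mk (P.T x.seq) (hT x)) ∧
      ∀ r : ℝ, 0 < r → ∀ y ∈ Metric.closedBall (0 : TridiagNewton.Omega P.s) r,
        ∀ z ∈ Metric.closedBall (0 : TridiagNewton.Omega P.s) r, ∀ k : ℕ,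
          |z.seq k - P.A (P.Adag z.seq) k| ≤ P.Z1 M r k ∧
          |P.A ((fderiv ℝ (fun x : TridiagNewton.Omega P.s => TridiagNewton.Omega.mk (P.f x.seq) (hf x))
              (P.xbarOmega + y) z).seq - P.Adag z.seq) k| ≤ P.Z2 M r k ∧
          |(fderiv ℝ (fun x : TridiagNewton.Omega P.s => TridiagNewton.Omega.mk (P.T x.seq) (hT x))
              (P.xbarOmega + y) z).seq k| ≤ P.Z M r k := by
  have hs0 : 0 ≤ P.s := by linarith
  obtain ⟨hf, hF⟩ := hA.exists_hasFDerivAt_f hs hsL hg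
  obtain ⟨Ac, hAc⟩ := hA.exists_clm_A hk0 hs0
  have hT : ∀ x : TridiagNewton.Omega P.s, TridiagNewton.MemOmega P.s (P.T x.seq) := by
    intro x
    have h := x.mem.sub (Ac (TridiagNewton.Omega.mk (P.f x.seq) (hf x))).mem
    rw [hAc] at h
    exact h
  have hTeq : (fun x : TridiagNewton.Omega P.s => TridiagNewton.Omega.mk (P.T x.seq) (hT x))
      = fun x => x - Ac (TridiagNewton.Omega.mk (P.f x.seq) (hf x)) := by
    funext x
    refine TridiagNewton.Omega.ext fun k => ?_
    rw [TridiagNewton.Omega.seq_sub, hAc]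
    rfl
  have hTd : ∀ x (F' : TridiagNewton.Omega P.s →L[ℝ] TridiagNewton.Omega (P.s - P.sL)),
      HasFDerivAt (fun x : TridiagNewton.Omega P.s => TridiagNewton.Omega.mk (P.f x.seq) (hf x))
        F' x →
      HasFDerivAt (fun x : TridiagNewton.Omega P.s => TridiagNewton.Omega.mk (P.T x.seq) (hT x))
        (ContinuousLinearMap.id ℝ (TridiagNewton.Omega P.s) - Ac.comp F') x := by
    intro x F' h
    rw [hTeq]
    exact (hasFDerivAt_id x).sub (Ac.hasFDerivAt.comp x h)
  refine ⟨hf, hT, fun x => ?_, fun x => ?_, fun r _ y hy z hz k => ?_⟩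
  · obtain ⟨F', h, -⟩ := hF x
    exact h.differentiableAt
  · obtain ⟨F', h, -⟩ := hF x
    exact (hTd x F' h).differentiableAt
  · rw [mem_closedBall_zero_iff] at hy hz
    obtain ⟨F', h, hz'⟩ := hF (P.xbarOmega + y)
    have h1 := (hA.tailDominant hk0).abs_sub_A_Adag_le hs hMY (TridiagNewton.Omega.abs_seq_le hz) k
    have h2 := hA.abs_A_sub_Adag_le hk0 hs hsL hg hm hN hMA hMY hy hz k
    rw [← hz'] at h2
    rw [h.fderiv, (hTd _ F' h).fderiv]
    refine ⟨h1, h2, ?_⟩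
    -- Splitting `A Df z = A(Df z - A† z) + A A† z` requires both arguments to lie in `Ω^{s-s_L}`,
    -- where the tail series converge and `A` is additive.
    have hadd := hA.A_add hk0 hs0 ((F' z).mem.sub (hA.memOmega_Adag hs0 z))
      (hA.memOmega_Adag hs0 z)
    rw [sub_add_cancel] at hadd
    have e : ((ContinuousLinearMap.id ℝ (TridiagNewton.Omega P.s) - Ac.comp F') z).seq k
        = z.seq k - P.A (F' z).seq k := by
      rw [← hAc]
      rfl
    rw [e, hadd, Pi.add_apply, sub_add_eq_sub_sub_swap]
    exact (abs_sub _ _).trans (add_le_add h1 h2)
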